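/- Let $K$ be an algebraically closed field and $A$ a finite-dimensional basic $K$-algebra with a complete system of orthogonal primitive idempotents $(e_i)_{i\in Q_0}$ (so $Ae_i\not\cong Ae_k$ for $i\neq k$); for instance $A=KQ/\mathcal I$ is a bound quiver algebra with vertex set $Q_0$ and $e_i$ are the trivial paths. All modules are finite-dimensional left modules. Write $P(i)=Ae_i$, $I(i)=\operatorname{Hom}_K(e_iA,K)$, $S(i)=\operatorname{top}P(i)$ and $[M:S(i)]=\dim_K e_iM$. Let $\leqslant$ be a partial order on $Q_0$ with a smallest element $1$ and a largest element $n$. Let $\Delta(i)$ be the largest factor module of $P(i)$, and $\nabla(i)$ the largest submodule of $I(i)$, having $[\,\cdot:S(k)]=0$ for all $k\not\leqslant i$. For a module $M$ with a filtration whose subquotients are standard modules, $(M:\Delta(k))$ denotes the number of subquotients isomorphic to $\Delta(k)$. Assume that $(A,\leqslant)$ is $1$-quasi-hereditary, that is: * (quasi-hereditary) for all $i$: $[\Delta(i):S(i)]=1$, and $P(i)$ has a filtration with standard subquotients, where $(P(i):\Delta(k))=0$ for $k\not\geqslant i$ and $(P(i):\Delta(i))=1$; * $[\Delta(i):S(k)]=(P(k):\Delta(i))=1$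 for all $k\leqslant i$; * $\operatorname{soc}P(k)\cong\operatorname{top}I(k)\cong S(1)$ for all $k$; * for all $i$ there are an injective homomorphism $\Delta(i)\hookrightarrow\Delta(n)$ and a surjective homomorphism $\nabla(n)\twoheadrightarrow\nabla(i)$. Let $j\in Q_0$, $\Lambda_{(j)}=\{i\in Q_0\mid i\leqslant j\}$, $r=|\Lambda_{(j)}|$, and $$\mathcal T(j)=\{(i_1,\dots,i_r)\mid i_m\in\Lambda_{(j)} \text{ for all } m,\ \ i_k\not\geqslant i_t \text{ for } 1\le k<t\le r\}.$$ A Jordan–Hölder filtration of $M$ is a finite chain of submodules from $0$ to $M$ with simple subquotients. (1) For each $i\in\Lambda_{(j)}$ there is an embedding $\Delta(i)\hookrightarrow\Delta(j)$, and all of them have the same image, again written $\Delta(i)\subseteq\Delta(j)$. The assignment $$(i_1,\dots,i_r)\longmapsto \bigl(0=J(0)\subset J(1)\subset\dots\subset J(r)=\Delta(j)\bigr),\qquad J(t)=\sum_{m=1}^{t}\Delta(i_m),$$ is a well-defined bijection from $\mathcal T(j)$ onto the set of Jordan–Hölder filtrations of $\Delta(j)$. Moreover $J(t)/J(t-1)\cong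 S(i_t)$ for $1\le t\le r$. (2) For each $i\in Q_0$ there is a surjection $\nabla(n)\twoheadrightarrow\nabla(i)$, and all of them have the same kernel $\mathfrak K(i)$; moreover $\mathfrak K(k)\subseteq\mathfrak K(i)$ if and only if $i\leqslant k$. Identify $\nabla(n)/\mathfrak K(j)$ with $\nabla(j)$ through any surjection $\nabla(n)\twoheadrightarrow\nabla(j)$. The assignment $$(i_1,\dots,i_r)\longmapsto \bigl(0=\mathfrak J(r)\subset\dots\subset\mathfrak J(1)\subset\mathfrak J(0)=\nabla(j)\bigr),\qquad \mathfrak J(t)=\Bigl(\bigcap_{m=1}^{t}\mathfrak K(i_m)\Bigr)/\mathfrak K(j)$$ (with $\mathfrak J(0)=\nabla(n)/\mathfrak K(j)$), is a well-defined bijection from $\mathcal T(j)$ onto the set of Jordan–Hölder filtrations of $\nabla(j)$. Moreover $\mathfrak J(t-1)/\mathfrak J(t)\cong S(i_t)$ for $1\le t\le r$. -/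

import Mathlib

namespace OneQH

noncomputable section

universe u v w z

/-! ## Modules over a finite-dimensional algebra with a chosen family of idempotents -/

section Algebra

variable {A : Type v} [Ring A]

/-- A primitive idempotent: nonzero, and not a sum of two nonzero orthogonal idempotents. -/
def IsPrimitiveIdempotent (a : A) : Prop :=
  IsIdempotentElem a ∧ a ≠ 0 ∧
    ∀ f g : A, IsIdempotentElem f → IsIdempotentElem g → f * g = 0 → g * f = 0 →
      a = f + g → f = 0 ∨ g = 0

variable {Q₀ : Type w}

/-- The indecomposable projective left module `P(i) = A e_i`, as a left ideal. -/
def proj (e : Q₀ → A) (i : Q₀) : Submodule A A := Submodule.span A {e i}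

/-- The radical of a module `M` is `Module.jacobson A M`, the intersection of its maximal
submodules; the top of `M` is `M / rad M`. -/
abbrev Top (A : Type v) [Ring A] (M : Type z) [AddCommGroup M] [Module A M] : Type z :=
  M ⧸ Module.jacobson A M

/-- The socle of a module: the sum of its simple submodules. -/
def socle (A : Type v) [Ring A] (M : Type z) [AddCommGroup M] [Module A M] : Submodule A M :=
  sSup {N : Submodule A M | IsSimpleModule A N}

/-- The simple module `S(i)`, the top of `P(i)`. -/
abbrev Simp (e : Q₀ → A) (i : Q₀) : Type v := Top A (proj e i)

/-- `(e i)_i` exhibits `A` as a basic algebra: a complete system of orthogonal primitive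
idempotents whose projectives `A e_i` are pairwise non-isomorphic. -/
structure IsBasicSystem [Fintype Q₀] (e : Q₀ → A) : Prop where
  complete : CompleteOrthogonalIdempotents e
  primitive : ∀ i, IsPrimitiveIdempotent (e i)
  basic : ∀ i j, Nonempty (proj e i ≃ₗ[A] proj e j) → i = j

/-- The subquotient `N / N'` (meant for `N' ≤ N`). -/
abbrev SubQuot {M : Type z} [AddCommGroup M] [Module A M] (N N' : Submodule A M) : Type z :=
  N ⧸ N'.submoduleOf N

end Algebra

/-! ## The dual of the algebra and the indecomposable injectives -/

section Dual

variable (K : Type u) (A : Type v) [Field K] [Ring A] [Algebra K A]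

/-- The `K`-dual `Hom_K(A, K)`, to be viewed as a left `A`-module via `(a • f) x = f (x * a)`. -/
def CoReg : Type (max u v) := A →ₗ[K] K

instance : AddCommGroup (CoReg K A) := inferInstanceAs (AddCommGroup (A →ₗ[K] K))

instance : Module K (CoReg K A) := inferInstanceAs (Module K (A →ₗ[K] K))

instance : FunLike (CoReg K A) A K := inferInstanceAs (FunLike (A →ₗ[K] K) A K)

variable {K A}

@[ext] theorem CoReg.ext {f g : CoReg K A} (h : ∀ x, f x = g x) : f = g := DFunLike.ext f g h

@[simp] theorem CoReg.add_apply (f g : CoReg K A) (x : A) : (f + g) x = f x + g x := rfl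

@[simp] theorem CoReg.zero_apply (x : A) : (0 : CoReg K A) x = 0 := rfl

@[simp] theorem CoReg.smul_apply' (c : K) (f : CoReg K A) (x : A) : (c • f) x = c * f x := rfl

theorem CoReg.map_add (f : CoReg K A) (x y : A) : f (x + y) = f x + f y :=
  LinearMap.map_add (f : A →ₗ[K] K) x y

theorem CoReg.map_zero (f : CoReg K A) : f 0 = 0 := LinearMap.map_zero (f : A →ₗ[K] K)

theorem CoReg.map_smul (f : CoReg K A) (c : K) (x : A) : f (c • x) = c * f x :=
  LinearMap.map_smul (f : A →ₗ[K] K) c x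

instance : SMul A (CoReg K A) where
  smul a f := LinearMap.comp (f : A →ₗ[K] K) (LinearMap.mulRight K a)

@[simp] theorem CoReg.smul_apply (a : A) (f : CoReg K A) (x : A) : (a • f) x = f (x * a) := rfl

instance : Module A (CoReg K A) where
  one_smul f := by ext x; simp
  mul_smul a b f := by ext x; simp [mul_assoc]
  smul_zero a := by ext x; simp
  smul_add a f g := by ext x; simp
  add_smul a b f := by ext x; simp [mul_add, CoReg.map_add]
  zero_smul f := by ext x; simp [CoReg.map_zero]

instance : IsScalarTower K A (CoReg K A) where
  smul_assoc c a f := by ext x; simp [CoReg.map_smul]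

variable {Q₀ : Type w}

/-- The indecomposable injective left module `I(i) = Hom_K(e_i A, K)`.  A functional on `e_i A` is
encoded as the functional on `A = e_i A ⊕ (1 - e_i) A` extending it by zero. -/
def inj (K : Type u) [Field K] [Algebra K A] (e : Q₀ → A) (i : Q₀) : Submodule A (CoReg K A) where
  carrier := {f | ∀ x, f (e i * x) = f x}
  add_mem' {f g} hf hg x := by
    rw [CoReg.add_apply, CoReg.add_apply, hf x, hg x]
  zero_mem' _ := rfl
  smul_mem' a f hf x := by
    rw [CoReg.smul_apply, CoReg.smul_apply, mul_assoc, hf (x * a)]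

end Dual

/-! ## Standard and costandard modules, quasi-hereditary algebras -/

section QuasiHereditary

variable {A : Type v} [Ring A] {Q₀ : Type w}

/-- The multiplicity `[M : S(i)] = dim_K (e_i M)`. -/
def mult (K : Type u) [Field K] [Algebra K A] (e : Q₀ → A) (M : Type z) [AddCommGroup M]
    [Module K M] [Module A M] [IsScalarTower K A M] (i : Q₀) : ℕ :=
  Module.finrank K (LinearMap.range (Algebra.lsmul K K M (e i)))

variable [PartialOrder Q₀]

/-- The smallest submodule `U` of `P(i)` such that `[P(i)/U : S(j)] = 0` for all `j ≰ i`. -/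
def stdKer (K : Type u) [Field K] [Algebra K A] (e : Q₀ → A) (i : Q₀) :
    Submodule A (proj e i) :=
  sInf {U : Submodule A (proj e i) | ∀ j, ¬ j ≤ i → mult K e (proj e i ⧸ U) j = 0}

/-- The standard module `Δ(i)`: the largest factor module of `P(i)` with `[Δ(i) : S(j)] = 0`
for all `j ≰ i`. -/
abbrev Std (K : Type u) [Field K] [Algebra K A] (e : Q₀ → A) (i : Q₀) : Type v :=
  proj e i ⧸ stdKer K e i

/-- The costandard module `∇(i)`: the largest submodule of `I(i)` with `[∇(i) : S(j)] = 0`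
for all `j ≰ i`. -/
def costd (K : Type u) [Field K] [Algebra K A] (e : Q₀ → A) (i : Q₀) :
    Submodule A (CoReg K A) :=
  sSup {N : Submodule A (CoReg K A) | N ≤ inj K e i ∧ ∀ j, ¬ j ≤ i → mult K e N j = 0}

/-- A `Δ`-good filtration `0 = sub 0 ≤ sub 1 ≤ ⋯ ≤ sub length = M`, whose `t`-th
subquotient is isomorphic to `Δ(label t)`. -/
structure StdFiltration (K : Type u) [Field K] [Algebra K A] (e : Q₀ → A) (M : Type z)
    [AddCommGroup M] [Module A M] where
  length : ℕ
  sub : Fin (length + 1) → Submodule A M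
  label : Fin length → Q₀
  sub_zero : sub 0 = ⊥
  sub_last : sub (Fin.last length) = ⊤
  mono : ∀ t : Fin length, sub t.castSucc ≤ sub t.succ
  factor : ∀ t : Fin length,
    Nonempty (SubQuot (sub t.succ) (sub t.castSucc) ≃ₗ[A] Std K e (label t))

/-- The number of subquotients `Δ(k)` in a `Δ`-good filtration. -/
def StdFiltration.count {K : Type u} [Field K] [Algebra K A] {e : Q₀ → A} {M : Type z}
    [AddCommGroup M] [Module A M] (F : StdFiltration K e M) (k : Q₀) : ℕ :=
  Nat.card {t : Fin F.length // F.label t = k}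

/-- `A`, with idempotents `e` and the partial order on the index set, is quasi-hereditary. -/
structure IsQuasiHereditary (K : Type u) [Field K] [Algebra K A] (e : Q₀ → A) : Prop where
  std_self : ∀ i, mult K e (Std K e i) i = 1
  proj_good : ∀ i, ∃ F : StdFiltration K e (proj e i),
    (∀ j, ¬ i ≤ j → F.count j = 0) ∧ F.count i = 1

/-- `A` is 1-quasi-hereditary; `⊥` and `⊤` are the smallest and the largest vertex. -/
structure IsOneQuasiHereditary [BoundedOrder Q₀] (K : Type u) [Field K] [Algebra K A]
    (e : Q₀ → A) : Prop extends IsQuasiHereditary K e where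
  std_mult : ∀ i j, j ≤ i → mult K e (Std K e i) j = 1
  proj_mult : ∀ i j, j ≤ i → ∃ F : StdFiltration K e (proj e j), F.count i = 1
  soc_proj : ∀ j, Nonempty (socle A (proj e j) ≃ₗ[A] Simp e (⊥ : Q₀))
  top_inj : ∀ j, Nonempty (Top A (inj K e j) ≃ₗ[A] Simp e (⊥ : Q₀))
  std_embeds : ∀ i, ∃ f : Std K e i →ₗ[A] Std K e (⊤ : Q₀), Function.Injective f
  costd_covers : ∀ i, ∃ f : costd K e (⊤ : Q₀) →ₗ[A] costd K e i, Function.Surjective f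

end QuasiHereditary

/-! ## Sequences and Jordan–Hölder filtrations -/

section Sequences

/-- The set `𝒯(j)` of sequences `(i_1, …, i_r)` in `Λ_(j) = {i | i ≤ j}`, `r = |Λ_(j)|`, such that
`i_k ≱ i_t` for `k < t`. -/
abbrev Seqs {Q₀ : Type w} [PartialOrder Q₀] (j : Q₀) : Type w :=
  {s : Fin (Nat.card (Set.Iic j)) → Q₀ // (∀ m, s m ≤ j) ∧ ∀ k t, k < t → ¬ s t ≤ s k}

/-- Jordan–Hölder filtrations of `M`: chains of submodules from `0` to `M`, each maximal in the
next. -/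
abbrev JHFiltration (A : Type v) [Ring A] (M : Type z) [AddCommGroup M] [Module A M] : Type z :=
  {c : CompositionSeries (Submodule A M) // c.head = ⊥ ∧ c.last = ⊤}

variable {A : Type v} [Ring A] {Q₀ : Type w} {M : Type z} [AddCommGroup M] [Module A M]

/-- `D(s_1) + ⋯ + D(s_t)`. -/
def partialSum (D : Q₀ → Submodule A M) {r : ℕ} (s : Fin r → Q₀) (t : ℕ) : Submodule A M :=
  ⨆ m : Fin r, ⨆ _ : m.val < t, D (s m)

/-- `𝔎(s_1) ∩ ⋯ ∩ 𝔎(s_t)`, which is all of `M` for `t = 0`. -/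
def partialInf (𝔎 : Q₀ → Submodule A M) {r : ℕ} (s : Fin r → Q₀) (t : ℕ) : Submodule A M :=
  ⨅ m : Fin r, ⨅ _ : m.val < t, 𝔎 (s m)

end Sequences

end

end OneQH

/-! Both `Std K e j` and `costd K e j` are thin: any nonzero element of `e k • M` generates all of
it. Since `∑ k, e k = 1`, a submodule is then determined by its support, the set of vertices at
which it is nonzero. Which supports occur depends only on the relation `e m • A • e k • M ≠ 0`. On
`Λ = Set.Iic j` this means `m ≤ k` for `Δ(j)` and `k ≤ m` for `∇(j)`, so submodules correspond to
lower, respectively upper, sets of `Λ`. A maximal chain of such sets adds one vertex at a time,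
which is a linear extension of `Λ`; the simple factor at each step is the one of the added vertex
(`IsOrderedThin.exists_bijective`).

For `Δ(j)` the relation follows from the multiplicities and from comparing all standard modules
inside `Δ(n)` (`IsOneQuasiHereditary.isOrderedThin_std`). For `∇(j)` the multiplicities come from
filtrations of `P(k)`, as in BGG reciprocity. An occurrence of `Δ(i)` gives a functional showing `e
k • ∇(i) ≠ 0`; the single occurrence of `Δ(n)` makes `e n • P(k)`, and hence `e k • ∇(n)`, at most
one-dimensional. The other `∇(j)` are quotients of `∇(n)`
(`IsOneQuasiHereditary.isOrderedThin_costd`). -/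

namespace OneQH

/-! ### Thin modules: submodules and their supports -/

section Thin

variable {A : Type*} [Ring A] {Q : Type*} {M : Type*} [AddCommGroup M] [Module A M]

/-- The set of indices `k` with `e k • N ≠ 0`. -/
def supp (e : Q → A) (N : Submodule A M) : Set Q := {k | ∃ x ∈ N, e k • x ≠ 0}

theorem supp_mono (e : Q → A) {N N' : Submodule A M} (h : N ≤ N') : supp e N ⊆ supp e N' :=
  fun _ ⟨x, hx, hne⟩ => ⟨x, h hx, hne⟩

/-- The vectors killed by `e k` form only an additive subgroup, not a submodule, hence the induction
on sums. -/
theorem mem_supp_iSup {ι : Sort*} {e : Q → A} {N : ι → Submodule A M} {k : Q} :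
    k ∈ supp e (⨆ i, N i) ↔ ∃ i, k ∈ supp e (N i) := by
  constructor
  · rintro ⟨x, hx, hne⟩
    by_contra! h
    refine hne ?_
    refine Submodule.iSup_induction N (motive := fun x => e k • x = 0) hx ?_ (smul_zero _) ?_
    · intro i y hy
      by_contra hy0
      exact h i ⟨y, hy, hy0⟩
    · intro y z hy hz
      rw [smul_add, hy, hz, add_zero]
  · rintro ⟨i, hi⟩
    exact supp_mono e (le_iSup N i) hi

/-- Every `e k • M` is generated by each of its nonzero elements. -/
def IsThin (e : Q → A) (M : Type*) [AddCommGroup M] [Module A M] : Prop :=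
  ∀ k (x y : M), e k • x ≠ 0 → ∃ a : A, a • e k • x = e k • y

theorem IsThin.smul_mem {e : Q → A} (h : IsThin e M) {N : Submodule A M} {k : Q}
    (hk : k ∈ supp e N) (y : M) : e k • y ∈ N := by
  obtain ⟨x, hx, hne⟩ := hk
  obtain ⟨a, ha⟩ := h k x y hne
  exact ha ▸ N.smul_mem _ (N.smul_mem _ hx)

theorem IsThin.le_iff [Fintype Q] {e : Q → A} (he : CompleteOrthogonalIdempotents e)
    (h : IsThin e M) {N N' : Submodule A M} : N ≤ N' ↔ supp e N ⊆ supp e N' := by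
  refine ⟨supp_mono e, fun hs x hx => ?_⟩
  rw [← one_smul A x, ← he.complete, Finset.sum_smul]
  refine N'.sum_mem fun k _ => ?_
  by_cases hk : e k • x = 0
  · rw [hk]; exact N'.zero_mem
  · exact h.smul_mem (hs ⟨x, hx, hk⟩) x

theorem IsThin.ext_supp [Fintype Q] {e : Q → A} (he : CompleteOrthogonalIdempotents e)
    (h : IsThin e M) {N N' : Submodule A M} (hs : supp e N = supp e N') : N = N' :=
  le_antisymm ((h.le_iff he).2 hs.le) ((h.le_iff he).2 hs.ge)

/-- Thinness makes all the `N i` contain the same `e k • x`. The condition on `⊤` matters only for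
an empty family. -/
theorem IsThin.mem_supp_iInf {ι : Sort*} {e : Q → A} (hid : ∀ k, IsIdempotentElem (e k))
    (h : IsThin e M) {N : ι → Submodule A M} {k : Q} :
    k ∈ supp e (⨅ i, N i) ↔ k ∈ supp e (⊤ : Submodule A M) ∧ ∀ i, k ∈ supp e (N i) := by
  constructor
  · exact fun hk => ⟨supp_mono e le_top hk, fun i => supp_mono e (iInf_le N i) hk⟩
  · rintro ⟨⟨x, -, hx⟩, hk⟩
    refine ⟨e k • x, (Submodule.mem_iInf _).2 fun i => h.smul_mem (hk i) x, ?_⟩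
    rwa [← mul_smul, hid k]

/-- `M` is thin with support `Λ`, and `e m • A • e k • M ≠ 0` exactly when `m ≤ k` in `Λ`. -/
structure IsOrderedThin [PartialOrder Q] (e : Q → A) (M : Type*) [AddCommGroup M] [Module A M]
    (Λ : Set Q) : Prop where
  thin : IsThin e M
  reach : ∀ m k, (∃ (a : A) (x : M), e m • a • e k • x ≠ 0) ↔ m ∈ Λ ∧ k ∈ Λ ∧ m ≤ k

variable [PartialOrder Q]

theorem IsOrderedThin.supp_top {e : Q → A} (hid : ∀ k, IsIdempotentElem (e k)) {Λ : Set Q}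
    (h : IsOrderedThin e M Λ) : supp e (⊤ : Submodule A M) = Λ := by
  ext k
  constructor
  · rintro ⟨x, -, hx⟩
    refine ((h.reach k k).1 ⟨1, x, ?_⟩).1
    rwa [one_smul, ← mul_smul, hid k]
  · intro hk
    obtain ⟨a, x, hx⟩ := (h.reach k k).2 ⟨hk, hk, le_rfl⟩
    exact ⟨_, trivial, hx⟩

/-- The `reach` relation closes supports downwards; conversely, the submodule generated by all `e k
• M` with `k ∈ S` reaches nothing outside a lower set `S`. -/
theorem IsOrderedThin.exists_supp_eq_iff {e : Q → A} (hid : ∀ k, IsIdempotentElem (e k))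
    {Λ : Set Q} (h : IsOrderedThin e M Λ) (S : Set Q) :
    (∃ N : Submodule A M, supp e N = S) ↔ S ⊆ Λ ∧ ∀ x ∈ S, ∀ y ∈ Λ, y ≤ x → y ∈ S := by
  constructor
  · rintro ⟨N, rfl⟩
    refine ⟨h.supp_top hid ▸ supp_mono e le_top, fun k hk m hm hmk => ?_⟩
    have hkΛ : k ∈ Λ := h.supp_top hid ▸ supp_mono e le_top hk
    obtain ⟨a, x, hx⟩ := (h.reach m k).2 ⟨hm, hkΛ, hmk⟩
    exact ⟨_, N.smul_mem a (h.thin.smul_mem hk x), hx⟩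
  · rintro ⟨hS, hlow⟩
    refine ⟨⨆ k : S, ⨆ x : M, Submodule.span A {e k • x}, Set.ext fun m => ?_⟩
    simp only [mem_supp_iSup]
    constructor
    · rintro ⟨⟨k, hk⟩, x, y, hy, hne⟩
      obtain ⟨a, rfl⟩ := Submodule.mem_span_singleton.1 hy
      obtain ⟨hm, -, hmk⟩ := (h.reach m k).1 ⟨a, x, hne⟩
      exact hlow k hk m hm hmk
    · intro hm
      have hmΛ : m ∈ supp e (⊤ : Submodule A M) := (h.supp_top hid).symm ▸ hS hm
      obtain ⟨x, -, hx⟩ := hmΛ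
      refine ⟨⟨m, hm⟩, x, e m • x, Submodule.mem_span_singleton_self _, ?_⟩
      rwa [← mul_smul, hid m]

end Thin

/-! ### Linear extensions and maximal chains of lower sets -/

section Combinatorics

variable {Q : Type*}

/-- The first `t` entries of a sequence. -/
def initialSet {r : ℕ} (s : Fin r → Q) (t : ℕ) : Set Q := {q | ∃ m : Fin r, m.val < t ∧ s m = q}

theorem initialSet_succ {r : ℕ} (s : Fin r → Q) (m : Fin r) :
    initialSet s (m.val + 1) = insert (s m) (initialSet s m.val) := by
  ext q
  simp only [initialSet, Set.mem_ofPred_eq, Set.mem_insert_iff]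
  constructor
  · rintro ⟨k, hk, rfl⟩
    rcases Nat.lt_succ_iff_lt_or_eq.1 hk with h | h
    · exact Or.inr ⟨k, h, rfl⟩
    · exact Or.inl (congrArg s (Fin.ext h))
  · rintro (rfl | ⟨k, hk, rfl⟩)
    · exact ⟨m, Nat.lt_succ_self _, rfl⟩
    · exact ⟨k, Nat.lt_succ_of_lt hk, rfl⟩

theorem notMem_initialSet {r : ℕ} {s : Fin r → Q} (hs : Function.Injective s) (m : Fin r) :
    s m ∉ initialSet s m.val := by
  rintro ⟨k, hk, hkm⟩
  exact hk.ne (congrArg Fin.val (hs hkm))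

theorem injective_of_forall_not_le [PartialOrder Q] {r : ℕ} {s : Fin r → Q} (hs : ∀ k t, k < t → ¬ s t ≤ s k) :
    Function.Injective s := by
  intro a b hab
  rcases lt_trichotomy a b with h | h | h
  · exact (hs a b h hab.ge).elim
  · exact h
  · exact (hs b a h hab.le).elim

theorem exists_eq_of_card [Finite Q] {r : ℕ} {Λ : Set Q} (hr : Nat.card Λ = r) {s : Fin r → Q}
    (hs : Function.Injective s) (hΛ : ∀ m, s m ∈ Λ) {q : Q} (hq : q ∈ Λ) : ∃ m, s m = q := by
  have hinj : Function.Injective (fun m => (⟨s m, hΛ m⟩ : Λ)) :=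
    fun a b h => hs (congrArg Subtype.val h)
  have hbij := (Nat.bijective_iff_injective_and_card _).2 ⟨hinj, by simp [hr]⟩
  obtain ⟨m, hm⟩ := hbij.2 ⟨q, hq⟩
  exact ⟨m, congrArg Subtype.val hm⟩

/-- If submodules correspond to relative lower sets of `Λ` through `F`, then Jordan–Hölder
filtrations correspond to linear extensions of `Λ`. -/
theorem exists_bijective_jhFiltration [PartialOrder Q] [Finite Q] {A : Type*} [Ring A]
    {M : Type*} [AddCommGroup M] [Module A M] {Λ : Set Q} (F : Submodule A M → Set Q)
    (hF : ∀ N N', N ≤ N' ↔ F N ⊆ F N')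
    (hrange : ∀ S, (∃ N, F N = S) ↔ S ⊆ Λ ∧ ∀ x ∈ S, ∀ y ∈ Λ, y ≤ x → y ∈ S)
    {r : ℕ} (hr : Nat.card Λ = r) :
    ∃ 𝒮 : {s : Fin r → Q // (∀ m, s m ∈ Λ) ∧ ∀ k t, k < t → ¬ s t ≤ s k} → JHFiltration A M,
      Function.Bijective 𝒮 ∧ ∀ s, (𝒮 s).1.length = r ∧
        ∀ t : Fin ((𝒮 s).1.length + 1), F ((𝒮 s).1 t) = initialSet s.1 t.val := by
  have hFinj : ∀ {N N'}, F N = F N' → N = N' := fun h =>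
    le_antisymm ((hF _ _).2 h.le) ((hF _ _).2 h.ge)
  have hsub : ∀ N, F N ⊆ Λ := fun N => ((hrange _).1 ⟨N, rfl⟩).1
  have hlow : ∀ N, ∀ x ∈ F N, ∀ y ∈ Λ, y ≤ x → y ∈ F N := fun N => ((hrange _).1 ⟨N, rfl⟩).2
  have hbot : F ⊥ = ∅ := by
    obtain ⟨N, hN⟩ := (hrange ∅).2 ⟨Set.empty_subset _, by simp⟩
    exact Set.subset_eq_empty (hN ▸ (hF ⊥ N).1 bot_le) rfl
  have htop : F ⊤ = Λ := by
    obtain ⟨N, hN⟩ := (hrange Λ).2 ⟨subset_rfl, fun _ _ _ h _ => h⟩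
    exact (hsub _).antisymm (hN ▸ (hF N ⊤).1 le_top)
  have hcov : ∀ {N N'} {x}, F N' = insert x (F N) → x ∉ F N → N ⋖ N' := by
    intro N N' x h hx
    refine ⟨lt_of_le_of_ne ((hF _ _).2 (h ▸ Set.subset_insert _ _)) ?_, ?_⟩
    · rintro rfl
      exact hx (h.symm ▸ Set.mem_insert _ _)
    · intro L hNL hLN'
      by_cases hxL : x ∈ F L
      · refine hLN'.not_ge ((hF _ _).2 ?_)
        rw [h]
        exact Set.insert_subset hxL ((hF _ _).1 hNL.le)
      · refine hNL.not_ge ((hF _ _).2 fun y hy => ?_)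
        rcases h ▸ (hF _ _).1 hLN'.le hy with rfl | hy'
        · exact (hxL hy).elim
        · exact hy'
  have hcov' : ∀ {N N'}, N ⋖ N' → ∃ x, F N' = insert x (F N) ∧ x ∉ F N := by
    intro N N' h
    have hne : (F N' \ F N).Nonempty := by
      rw [Set.sdiff_nonempty]
      exact fun hs => h.lt.not_ge ((hF _ _).2 hs)
    -- Minimality of `x` keeps `insert x (F N)` a lower set, so it is the support of some `L`
    -- between `N` and `N'`; the covering relation then forces `L = N'`.
    obtain ⟨x, hx⟩ := (Set.toFinite (F N' \ F N)).exists_minimal hne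
    refine ⟨x, ?_, hx.1.2⟩
    obtain ⟨L, hL⟩ := (hrange (insert x (F N))).2 ⟨Set.insert_subset (hsub _ hx.1.1) (hsub _), by
      rintro z (rfl | hz) y hy hyz
      · by_cases hyN : y ∈ F N
        · exact Or.inr hyN
        · exact Or.inl (le_antisymm hyz (hx.2 ⟨hlow _ _ hx.1.1 _ hy hyz, hyN⟩ hyz))
      · exact Or.inr (hlow _ _ hz _ hy hyz)⟩
    have h1 : N ≤ L := (hF _ _).2 (hL ▸ Set.subset_insert _ _)
    have h2 : L ≤ N' := (hF _ _).2 (hL ▸ Set.insert_subset hx.1.1 ((hF _ _).1 h.le))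
    rcases h.eq_or_eq h1 h2 with rfl | rfl
    · exact (hx.1.2 (hL.symm ▸ Set.mem_insert _ _)).elim
    · exact hL
  have hex : ∀ s : {s : Fin r → Q // (∀ m, s m ∈ Λ) ∧ ∀ k t, k < t → ¬ s t ≤ s k}, ∀ t : ℕ,
      ∃ N, F N = initialSet s.1 t := by
    rintro ⟨s, hs, hs'⟩ t
    have hinj := injective_of_forall_not_le hs'
    refine (hrange _).2 ⟨?_, ?_⟩
    · rintro _ ⟨m, -, rfl⟩
      exact hs m
    · rintro _ ⟨m, hm, rfl⟩ y hy hym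
      -- By counting, the sequence exhausts `Λ`, so `y` is an entry; it cannot come after `s m`,
      -- since it is below it.
      obtain ⟨k, rfl⟩ := exists_eq_of_card hr hinj hs hy
      refine ⟨k, lt_of_le_of_lt ?_ hm, rfl⟩
      by_contra! hk
      exact hs' m k hk hym
  choose G hG using hex
  refine ⟨fun s => ⟨⟨r, fun t => G s t.val, fun i => ?_⟩, ?_, ?_⟩, ⟨?_, ?_⟩, fun s => ⟨rfl, ?_⟩⟩
  · refine hcov (x := s.1 i) ?_ ?_
    · rw [hG, hG, Fin.val_succ, initialSet_succ]; rfl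
    · rw [hG]
      exact notMem_initialSet (injective_of_forall_not_le s.2.2) i
  · refine hFinj ((hG s 0).trans ?_)
    rw [hbot]
    ext q
    simp [initialSet]
  · refine hFinj ((hG s r).trans ?_)
    rw [htop]
    ext q
    constructor
    · rintro ⟨m, -, rfl⟩
      exact s.2.1 m
    · intro hq
      obtain ⟨m, hm⟩ := exists_eq_of_card hr (injective_of_forall_not_le s.2.2) s.2.1 hq
      exact ⟨m, m.2, hm⟩
  · intro s s' hss
    have hfun : ∀ t : Fin (r + 1), G s t.val = G s' t.val := by
      have h1 := congrArg Subtype.val hss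
      intro t
      exact congrFun (eq_of_heq (RelSeries.mk.inj h1).2) t
    have hset : ∀ t ≤ r, initialSet s.1 t = initialSet s'.1 t := fun t ht => by
      rw [← hG, ← hG]
      exact congrArg F (hfun ⟨t, Nat.lt_succ_of_le ht⟩)
    refine Subtype.ext (funext fun m => ?_)
    -- The entry `s m` is recovered as the only vertex that step `m` adds.
    have h1 : s.1 m ∈ initialSet s'.1 (m.val + 1) :=
      hset (m.val + 1) m.2 ▸ (initialSet_succ s.1 m).symm ▸ Set.mem_insert _ _
    rw [initialSet_succ, ← hset m.val m.2.le] at h1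
    exact h1.resolve_right (notMem_initialSet (injective_of_forall_not_le s.2.2) m)
  · rintro ⟨c, hc0, hc1⟩
    have hstep : ∀ i : Fin c.length,
        ∃ x, F (c i.succ) = insert x (F (c i.castSucc)) ∧ x ∉ F (c i.castSucc) :=
      fun i => hcov' (c.step i)
    -- The preimage of a filtration lists the vertices added at its successive steps.
    choose x hx hx' using hstep
    have hinit : ∀ t : ℕ, ∀ ht : t < c.length + 1, F (c ⟨t, ht⟩) = initialSet x t := by
      intro t
      induction t with
      | zero =>
        intro ht
        refine (congrArg F hc0).trans ?_
        rw [hbot]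
        ext q
        simp [initialSet]
      | succ t ih =>
        intro ht
        have ht' : t < c.length := Nat.lt_of_succ_lt_succ ht
        have h1 := hx ⟨t, ht'⟩
        have h2 := initialSet_succ x ⟨t, ht'⟩
        rw [h2, ← ih (Nat.lt_succ_of_lt ht')]
        exact h1
    have hmem : ∀ k m : Fin c.length, k < m → x k ∈ F (c m.castSucc) := fun k m h => by
      rw [show m.castSucc = ⟨m.val, Nat.lt_succ_of_lt m.2⟩ from rfl, hinit]
      exact ⟨k, h, rfl⟩
    have hxinj : Function.Injective x := by
      intro k m hkm
      rcases lt_trichotomy k m with h | h | h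
      · exact (hx' m (hkm ▸ hmem k m h)).elim
      · exact h
      · exact (hx' k (hkm.symm ▸ hmem m k h)).elim
    have hxΛ : ∀ m, x m ∈ Λ := fun m => hsub (c m.succ) (hx m ▸ Set.mem_insert _ _)
    have hlen : c.length = r := by
      have hall : Set.range x = Λ := by
        rw [← htop, ← hc1]
        refine Eq.trans ?_ (hinit c.length (Nat.lt_succ_self _)).symm
        ext q
        exact ⟨fun ⟨m, hm⟩ => ⟨m, m.2, hm⟩, fun ⟨m, _, hm⟩ => ⟨m, hm⟩⟩
      rw [← hr, ← hall, Nat.card_range_of_injective hxinj, Nat.card_fin]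
    subst hlen
    refine ⟨⟨x, hxΛ, fun k t hkt hle => hx' t ?_⟩, ?_⟩
    · exact hlow _ _ (hmem k t hkt) _ (hxΛ t) hle
    · refine Subtype.ext (RelSeries.ext rfl (funext fun t => ?_))
      exact hFinj ((hG _ _).trans (hinit t.val t.2).symm)
  · intro t
    exact hG s t.val

end Combinatorics

/-! ### Primitive idempotents and local projectives -/

section Local

variable {A : Type*} [Ring A] {Q : Type*}

theorem smul_eq_self_of_mem_span {a : A} (ha : IsIdempotentElem a) {x : A}
    (hx : x ∈ Submodule.span A {a}) : x * a = x := by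
  obtain ⟨b, rfl⟩ := Submodule.mem_span_singleton.1 hx
  rw [smul_eq_mul, mul_assoc, ha]

/-- The components `x ∈ X` and `y ∈ Y` of the generator `a` are orthogonal idempotents with sum `a`.
-/
theorem IsPrimitiveIdempotent.eq_bot_or_eq_bot {a : A} (ha : IsPrimitiveIdempotent a)
    {X Y : Submodule A (Submodule.span A {a})} (h : IsCompl X Y) : X = ⊥ ∨ Y = ⊥ := by
  obtain ⟨hid, -, hprim⟩ := ha
  let g : Submodule.span A {a} := ⟨a, Submodule.mem_span_singleton_self a⟩
  have hgen : ∀ x : Submodule.span A {a}, x = x.1 • g := fun x =>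
    Subtype.ext (smul_eq_self_of_mem_span hid x.2).symm
  obtain ⟨x, hx, y, hy, hxy⟩ := Submodule.mem_sup.1 (h.sup_eq_top ▸ Submodule.mem_top : g ∈ X ⊔ Y)
  have hdis : ∀ z ∈ X, z ∈ Y → z = 0 := fun z h1 h2 =>
    Submodule.disjoint_def.1 h.disjoint z h1 h2
  have key : ∀ z : Submodule.span A {a}, z = z.1 • x + z.1 • y := fun z => by
    rw [← smul_add, hxy]; exact hgen z
  have hx0 : x.1 • y = 0 := by
    refine hdis _ ?_ (Y.smul_mem _ hy)
    rw [eq_sub_of_add_eq' (key x).symm]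
    exact X.sub_mem hx (X.smul_mem _ hx)
  have hy0 : y.1 • x = 0 := by
    refine hdis _ (X.smul_mem _ hx) ?_
    rw [eq_sub_of_add_eq (key y).symm]
    exact Y.sub_mem hy (Y.smul_mem _ hy)
  have hxx : x.1 • x = x := by simpa [hx0] using (key x).symm
  have hyy : y.1 • y = y := by simpa [hy0] using (key y).symm
  rcases hprim x.1 y.1 (congrArg Subtype.val hxx) (congrArg Subtype.val hyy)
    (congrArg Subtype.val hx0) (congrArg Subtype.val hy0) (congrArg Subtype.val hxy).symm with h0 | h0
  · left
    have hx' : x = 0 := Subtype.ext h0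
    refine (Submodule.eq_bot_iff _).2 fun z hz => hdis z hz ?_
    rw [key z, hx', smul_zero, zero_add]
    exact Y.smul_mem _ hy
  · right
    have hy' : y = 0 := Subtype.ext h0
    refine (Submodule.eq_bot_iff _).2 fun z hz => hdis z ?_ hz
    rw [key z, hy', smul_zero, add_zero]
    exact X.smul_mem _ hx

/-- The projective of a primitive idempotent of an Artinian ring has only one maximal submodule. -/
theorem IsPrimitiveIdempotent.eq_of_isCoatom [IsArtinianRing A] {a : A}
    (ha : IsPrimitiveIdempotent a) {U V : Submodule A (Submodule.span A {a})}
    (hU : IsCoatom U) (hV : IsCoatom V) : U = V := by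
  by_contra hUV
  have hid := ha.1
  let P := Submodule.span A {a}
  have : Module.Finite A P := Module.Finite.span_singleton A a
  let g : P := ⟨a, Submodule.mem_span_singleton_self a⟩
  have hgen : ∀ x : P, x = x.1 • g := fun x =>
    Subtype.ext (smul_eq_self_of_mem_span hid x.2).symm
  have htop : U ⊔ V = ⊤ := hU.sup_eq_top_of_ne hV hUV
  obtain ⟨u, hu, v, hv, huv⟩ := Submodule.mem_sup.1 (htop ▸ Submodule.mem_top : g ∈ U ⊔ V)
  -- Right multiplication by `w`, for `w` in `P`.
  let R : A → Module.End A P := fun w =>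
    { toFun := fun x => x.1 • (w • g)
      map_add' := fun x y => add_smul _ _ _
      map_smul' := fun c x => mul_smul _ _ _ }
  have hnil : ∀ W : Submodule A P, IsCoatom W → ∀ w ∈ W, IsNilpotent (R w.1) := by
    intro W hW w hw
    have hrange : ∀ x, R w.1 x ∈ W := fun x => W.smul_mem _ ((hgen w) ▸ hw)
    -- Fitting decomposition: one summand vanishes by primitivity, and the range cannot be
    -- everything because it lies in `W`. The exponent `n + 1` ensures that one factor `R w` can be
    -- split off.
    obtain ⟨n, hn⟩ := (LinearMap.eventually_isCompl_ker_pow_range_pow (R w.1)).exists_forall_of_atTop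
    have hc := hn (n + 1) (Nat.le_succ n)
    rcases ha.eq_bot_or_eq_bot hc with h | h
    · have htop := h ▸ hc.sup_eq_top
      rw [bot_sup_eq] at htop
      refine (hW.1 (top_le_iff.1 (htop.ge.trans ?_))).elim
      rintro _ ⟨x, rfl⟩
      rw [pow_succ']
      exact hrange _
    · exact ⟨n + 1, LinearMap.range_eq_bot.1 h⟩
  -- If `U ≠ V`, the generator is `u + v`; then `R v = 1 - R u` is both nilpotent and a unit.
  have hsum : R u.1 + R v.1 = 1 := by
    ext x : 1
    change x.1 • (u.1 • g) + x.1 • (v.1 • g) = x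
    rw [← hgen u, ← hgen v, ← smul_add, huv, ← hgen x]
  have hRv : R v.1 = 1 - R u.1 := eq_sub_of_add_eq' hsum
  have hunit : IsUnit (R v.1) := hRv ▸ (hnil U hU u hu).isUnit_one_sub
  have hnon : Nontrivial P := ⟨g, 0, fun h => ha.2.1 (congrArg Subtype.val h)⟩
  exact (hnil V hV v hv).not_isUnit hunit

/-- The map `P(i) → S` sending `e i` to `e i • x` is onto; its kernel is the only maximal submodule
of `P(i)`, hence the radical. -/
theorem nonempty_equiv_simp [IsArtinianRing A] {e : Q → A} {i : Q}
    (hi : IsPrimitiveIdempotent (e i)) {S : Type*} [AddCommGroup S] [Module A S]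
    [IsSimpleModule A S] {x : S} (hx : e i • x ≠ 0) : Nonempty (S ≃ₗ[A] Simp e i) := by
  let f : proj e i →ₗ[A] S := (LinearMap.toSpanSingleton A S x).comp (proj e i).subtype
  have hsurj : Function.Surjective f := by
    refine (LinearMap.surjective_or_eq_zero f).resolve_right fun h => hx ?_
    exact LinearMap.congr_fun h ⟨e i, Submodule.mem_span_singleton_self _⟩
  have hker : IsCoatom (LinearMap.ker f) := by
    rw [← isSimpleModule_iff_isCoatom]
    exact IsSimpleModule.congr (f.quotKerEquivOfSurjective hsurj)
  have hjac : Module.jacobson A (proj e i) = LinearMap.ker f := by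
    refine le_antisymm (sInf_le hker) (le_sInf fun U hU => ?_)
    exact (hi.eq_of_isCoatom hker hU).le
  exact ⟨((Submodule.quotEquivOfEq _ _ hjac).trans (f.quotKerEquivOfSurjective hsurj)).symm⟩

end Local

/-! ### Composition factors of ordered thin modules -/

section Thin

variable {A : Type*} [Ring A] [IsArtinianRing A] {Q : Type*} {M : Type*}
  [AddCommGroup M] [Module A M]

theorem nonempty_subQuot_equiv_simp {e : Q → A} {i : Q} (hi : IsPrimitiveIdempotent (e i))
    {N N' : Submodule A M} (hcov : N' ⋖ N)
    (hN : i ∈ supp e N) (hN' : i ∉ supp e N') : Nonempty (SubQuot N N' ≃ₗ[A] Simp e i) := by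
  have : IsSimpleModule A (SubQuot N N') := (covBy_iff_quot_is_simple hcov.le).1 hcov
  obtain ⟨x, hx, hne⟩ := hN
  refine nonempty_equiv_simp hi (x := (N'.submoduleOf N).mkQ ⟨x, hx⟩) fun h => ?_
  rw [← map_smul, Submodule.mkQ_apply, Submodule.Quotient.mk_eq_zero] at h
  refine hN' ⟨e i • x, h, ?_⟩
  rwa [← mul_smul, hi.1]

/-- Linear extensions of `Λ` correspond to Jordan–Hölder filtrations of an ordered thin module. -/
theorem IsOrderedThin.exists_bijective [Fintype Q] [PartialOrder Q] {e : Q → A}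
    (he : CompleteOrthogonalIdempotents e) (hp : ∀ i, IsPrimitiveIdempotent (e i)) {Λ : Set Q}
    (h : IsOrderedThin e M Λ) {r : ℕ} (hr : Nat.card Λ = r) :
    ∃ 𝒮 : {s : Fin r → Q // (∀ m, s m ∈ Λ) ∧ ∀ k t, k < t → ¬ s t ≤ s k} → JHFiltration A M,
      Function.Bijective 𝒮 ∧ ∀ s, (𝒮 s).1.length = r ∧
        (∀ t : Fin ((𝒮 s).1.length + 1), supp e ((𝒮 s).1 t) = initialSet s.1 t.val) ∧
        -- Stating the factors for any submodules with the right supports lets them apply directly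
        -- to partial sums and intersections.
        ∀ (m : Fin r) (N N' : Submodule A M), supp e N = initialSet s.1 (m.val + 1) →
          supp e N' = initialSet s.1 m.val → Nonempty (SubQuot N N' ≃ₗ[A] Simp e (s.1 m)) := by
  have hid := fun k => (hp k).1
  obtain ⟨𝒮, h𝒮, hs⟩ := exists_bijective_jhFiltration (A := A) (M := M) (supp e)
    (fun N N' => h.thin.le_iff he) (h.exists_supp_eq_iff hid) hr
  refine ⟨𝒮, h𝒮, fun s => ⟨(hs s).1, (hs s).2, fun m N N' hN hN' => ?_⟩⟩
  have hinj := injective_of_forall_not_le s.2.2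
  obtain ⟨hlen, hsupp⟩ := hs s
  have hm : m.val < (𝒮 s).1.length := hlen.symm ▸ m.2
  have h1 : N' = (𝒮 s).1 (Fin.castSucc ⟨m.val, hm⟩) :=
    h.thin.ext_supp he (hN'.trans (hsupp (Fin.castSucc ⟨m.val, hm⟩)).symm)
  have h2 : N = (𝒮 s).1 (Fin.succ ⟨m.val, hm⟩) :=
    h.thin.ext_supp he (hN.trans (hsupp (Fin.succ ⟨m.val, hm⟩)).symm)
  refine nonempty_subQuot_equiv_simp (hp _) ?_ ?_ ?_
  · rw [h1, h2]
    exact (𝒮 s).1.step ⟨m.val, hm⟩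
  · rw [hN, initialSet_succ]
    exact Set.mem_insert _ _
  · rw [hN']
    exact notMem_initialSet hinj m

end Thin

/-! ### Multiplicities zero and one -/

section Mult

variable {K A Q : Type*} [Field K] [Ring A] [Algebra K A] {e : Q → A}
  {M : Type*} [AddCommGroup M] [Module K M] [Module A M] [IsScalarTower K A M]

theorem mult_eq_zero_iff [Module.Finite K M] {k : Q} :
    mult K e M k = 0 ↔ ∀ x : M, e k • x = 0 := by
  rw [mult, Submodule.finrank_eq_zero, LinearMap.range_eq_bot, LinearMap.ext_iff]
  rfl

theorem exists_smul_ne_zero_of_mult_eq_one {k : Q} (h : mult K e M k = 1) :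
    ∃ x : M, e k • x ≠ 0 := by
  by_contra! h0
  have : LinearMap.range (Algebra.lsmul K K M (e k)) = ⊥ :=
    LinearMap.range_eq_bot.2 (LinearMap.ext h0)
  rw [mult, this, finrank_bot] at h
  exact zero_ne_one h

theorem exists_smul_eq_of_mult_eq_one {k : Q} (h : mult K e M k = 1) (x y : M)
    (hx : e k • x ≠ 0) : ∃ c : K, c • e k • x = e k • y := by
  let v : LinearMap.range (Algebra.lsmul K K M (e k)) := ⟨e k • x, x, rfl⟩
  have hv : v ≠ 0 := fun h => hx (congrArg Subtype.val h)
  obtain ⟨c, hc⟩ := (finrank_eq_one_iff_of_nonzero' v hv).1 h ⟨e k • y, y, rfl⟩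
  exact ⟨c, congrArg Subtype.val hc⟩

end Mult

/-! ### Traces of projectives -/

section Trace

variable {A Q : Type*} [Ring A] {V : Type*} [AddCommGroup V] [Module A V]

/-- The submodule generated by `e u • N` for `u ∈ U`. -/
def trace (e : Q → A) (U : Set Q) (N : Submodule A V) : Submodule A V :=
  Submodule.span A {y | ∃ u ∈ U, ∃ x ∈ N, e u • x = y}

theorem smul_mem_trace (e : Q → A) {U : Set Q} {N : Submodule A V} {u : Q} (hu : u ∈ U) {x : V}
    (hx : x ∈ N) : e u • x ∈ trace e U N :=
  Submodule.subset_span ⟨u, hu, x, hx, rfl⟩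

theorem trace_le_iff {e : Q → A} {U : Set Q} {N L : Submodule A V} :
    trace e U N ≤ L ↔ ∀ u ∈ U, ∀ x ∈ N, e u • x ∈ L := by
  refine Submodule.span_le.trans ⟨fun h u hu x hx => h ⟨u, hu, x, hx, rfl⟩, ?_⟩
  rintro h _ ⟨u, hu, x, hx, rfl⟩
  exact h u hu x hx

theorem trace_le (e : Q → A) (U : Set Q) (N : Submodule A V) : trace e U N ≤ N :=
  trace_le_iff.2 fun _ _ _ hx => N.smul_mem _ hx

end Trace

/-! ### Standard modules and good filtrations -/

section Std

variable {K A Q : Type*} [Field K] [Ring A] [Algebra K A] {e : Q → A}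

/-- The generator `e i` of `P(i)`. -/
def projGen (e : Q → A) (i : Q) : proj e i := ⟨e i, Submodule.mem_span_singleton_self _⟩

theorem smul_projGen {i : Q} (hi : IsIdempotentElem (e i)) : e i • projGen e i = projGen e i :=
  Subtype.ext hi

theorem coe_smul_projGen {i : Q} (hi : IsIdempotentElem (e i)) (x : proj e i) :
    x.1 • projGen e i = x :=
  Subtype.ext (smul_eq_self_of_mem_span hi x.2)

theorem finite_proj_quotient [FiniteDimensional K A] (i : Q) (U : Submodule A (proj e i)) :
    Module.Finite K (proj e i ⧸ U) := by
  have : Module.Finite A (proj e i) := Module.Finite.span_singleton A (e i)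
  exact Module.Finite.trans A _

variable [PartialOrder Q]

theorem smul_mem_stdKer [FiniteDimensional K A] {i u : Q} (hu : ¬ u ≤ i) (x : proj e i) :
    e u • x ∈ stdKer K e i := by
  refine (Submodule.mem_sInf).2 fun U hU => ?_
  have := finite_proj_quotient (K := K) i U
  have h := mult_eq_zero_iff.1 (hU u hu) (U.mkQ x)
  rwa [← map_smul, Submodule.mkQ_apply, Submodule.Quotient.mk_eq_zero] at h

theorem smul_std_eq_zero [FiniteDimensional K A] {i u : Q} (hu : ¬ u ≤ i) (x : Std K e i) :
    e u • x = 0 := by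
  obtain ⟨x, rfl⟩ := (stdKer K e i).mkQ_surjective x
  rw [← map_smul, Submodule.mkQ_apply, Submodule.Quotient.mk_eq_zero]
  exact smul_mem_stdKer hu x

variable (K) in
/-- The canonical generator of `Δ(i)`. -/
def stdGen (e : Q → A) (i : Q) : Std K e i := (stdKer K e i).mkQ (projGen e i)

theorem smul_stdGen {i : Q} (hi : IsIdempotentElem (e i)) : e i • stdGen K e i = stdGen K e i := by
  rw [stdGen, ← map_smul, smul_projGen hi]

theorem exists_smul_stdGen {i : Q} (hi : IsIdempotentElem (e i)) (x : Std K e i) :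
    ∃ a : A, a • stdGen K e i = x := by
  obtain ⟨x, rfl⟩ := (stdKer K e i).mkQ_surjective x
  exact ⟨x.1, by rw [stdGen, ← map_smul, coe_smul_projGen hi]⟩

variable {V : Type*} [AddCommGroup V] [Module A V]

theorem exists_map_of_subQuot_equiv {l : Q} {N N' : Submodule A V}
    (h : Nonempty (SubQuot N N' ≃ₗ[A] Std K e l)) :
    ∃ ψ : N →ₗ[A] Std K e l, Function.Surjective ψ ∧ ∀ y, ψ y = 0 ↔ (y : V) ∈ N' := by
  obtain ⟨φ⟩ := h
  refine ⟨φ.toLinearMap.comp (N'.submoduleOf N).mkQ,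
    φ.surjective.comp (Submodule.mkQ_surjective _), fun y => ?_⟩
  rw [LinearMap.comp_apply, LinearEquiv.coe_coe, LinearEquiv.map_eq_zero_iff, Submodule.mkQ_apply,
    Submodule.Quotient.mk_eq_zero]
  rfl

theorem smul_mem_of_not_le [FiniteDimensional K A] {l u : Q} {N N' : Submodule A V}
    (h : Nonempty (SubQuot N N' ≃ₗ[A] Std K e l)) (hu : ¬ u ≤ l) {x : V} (hx : x ∈ N) :
    e u • x ∈ N' := by
  obtain ⟨ψ, -, hψ⟩ := exists_map_of_subQuot_equiv h
  exact (hψ (e u • ⟨x, hx⟩)).1 (by rw [map_smul, smul_std_eq_zero hu])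

/-- A generator of a subquotient isomorphic to `Δ(l)`. -/
theorem exists_gen_of_subQuot_equiv {l : Q} (hl : IsIdempotentElem (e l)) {N N' : Submodule A V}
    (h : Nonempty (SubQuot N N' ≃ₗ[A] Std K e l)) :
    ∃ x ∈ N, e l • x = x ∧ (∀ y ∈ N, ∃ a : A, y - a • x ∈ N') ∧
      ∀ c : A, c • x ∈ N' → c • projGen e l ∈ stdKer K e l := by
  obtain ⟨ψ, hψ, hker⟩ := exists_map_of_subQuot_equiv h
  obtain ⟨x, hx⟩ := hψ (stdGen K e l)
  have hx' : ψ (e l • x) = stdGen K e l := by rw [map_smul, hx, smul_stdGen hl]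
  refine ⟨e l • x.1, N.smul_mem _ x.2, by rw [← mul_smul, hl], fun y hy => ?_, fun c hc => ?_⟩
  · obtain ⟨a, ha⟩ := exists_smul_stdGen hl (ψ ⟨y, hy⟩)
    refine ⟨a, (hker (⟨y, hy⟩ - a • e l • x)).1 ?_⟩
    rw [map_sub, map_smul, hx', ha, sub_self]
  · have h0 := (hker (c • e l • x)).2 hc
    rw [map_smul, hx', stdGen, ← map_smul, Submodule.mkQ_apply, Submodule.Quotient.mk_eq_zero] at h0
    exact h0

theorem StdFiltration.exists_label_eq {M : Type*} [AddCommGroup M] [Module A M]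
    (F : StdFiltration K e M) {k : Q} (h : F.count k = 1) :
    ∃ t₀, F.label t₀ = k ∧ ∀ t, F.label t = k → t = t₀ := by
  obtain ⟨hs, ⟨t₀⟩⟩ := Nat.card_eq_one_iff_unique.1 h
  exact ⟨t₀.1, t₀.2, fun t ht => congrArg Subtype.val (hs.elim ⟨t, ht⟩ t₀)⟩

theorem StdFiltration.label_ne {M : Type*} [AddCommGroup M] [Module A M]
    (F : StdFiltration K e M) {k : Q} (h : F.count k = 0) (t) : F.label t ≠ k := fun ht => by
  have : Nonempty {t : Fin F.length // F.label t = k} := ⟨⟨t, ht⟩⟩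
  exact (Nat.card_pos).ne' h

theorem StdFiltration.monotone {M : Type*} [AddCommGroup M] [Module A M]
    (F : StdFiltration K e M) : Monotone F.sub := Fin.monotone_iff_le_succ.2 F.mono

/-- `P(l)` has `Δ(l)` as the quotient by the trace of the projectives `P(u)` with `l < u`. -/
theorem IsQuasiHereditary.stdKer_le_trace [FiniteDimensional K A]
    (hid : ∀ k, IsIdempotentElem (e k)) (hA : IsQuasiHereditary K e) (l : Q) :
    stdKer K e l ≤ trace e (Set.Ioi l) (⊤ : Submodule A (proj e l)) := by
  obtain ⟨F, hF0, hF1⟩ := hA.proj_good l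
  obtain ⟨t₀, ht₀, huniq⟩ := F.exists_label_eq hF1
  set T := trace e (Set.Ioi l) (⊤ : Submodule A (proj e l))
  have hlabel : ∀ t, t ≠ t₀ → l < F.label t := by
    intro t ht
    refine lt_of_le_of_ne ?_ fun h => ht (huniq t h.symm)
    by_contra hle
    exact F.label_ne (hF0 _ hle) t rfl
  have hstep : ∀ t, t ≠ t₀ → F.sub t.succ ≤ F.sub t.castSucc ⊔ T := by
    intro t ht y hy
    obtain ⟨x, hx, hlx, hgen, -⟩ := exists_gen_of_subQuot_equiv (hid _) (F.factor t)
    obtain ⟨a, ha⟩ := hgen y hy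
    rw [← sub_add_cancel y (a • x)]
    refine Submodule.add_mem_sup ha (T.smul_mem a ?_)
    rw [← hlx]
    exact smul_mem_trace e (hlabel t ht) Submodule.mem_top
  -- Every factor except the one at `t₀` is some `Δ(u)` with `l < u`, generated by a vector that `e
  -- u` fixes, so it is absorbed by `T`.
  have hlow : ∀ s : Fin (F.length + 1), s ≤ t₀.castSucc → F.sub s ≤ T := by
    intro s
    induction s using Fin.induction with
    | zero => exact fun _ => F.sub_zero ▸ bot_le
    | succ i ih =>
      intro hi
      have hi' : i < t₀ := Fin.succ_le_castSucc_iff.1 hi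
      exact (hstep i hi'.ne).trans (sup_le (ih (Fin.castSucc_le_castSucc_iff.2 hi'.le)) le_rfl)
  have hhigh : ∀ s : Fin (F.length + 1), t₀.succ ≤ s → F.sub s ≤ F.sub t₀.succ ⊔ T := by
    intro s
    induction s using Fin.induction with
    | zero => exact fun h => ((Fin.succ_pos t₀).not_ge h).elim
    | succ i ih =>
      intro hi
      rcases eq_or_ne i t₀ with rfl | hne
      · exact le_sup_left
      · have hi' : t₀ < i := lt_of_le_of_ne (Fin.succ_le_succ_iff.1 hi) hne.symm
        exact (hstep i hne).trans
          (sup_le (ih (Fin.succ_le_castSucc_iff.2 hi')) le_sup_right)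
  have htop : F.sub t₀.succ ⊔ T = ⊤ :=
    top_le_iff.1 (F.sub_last ▸ hhigh (Fin.last _) (Fin.le_last _))
  obtain ⟨φ⟩ := F.factor t₀
  rw [ht₀] at φ
  have hTle : T ≤ stdKer K e l :=
    trace_le_iff.2 fun u hu x _ => smul_mem_stdKer (not_le_of_gt hu) x
  have hkill : (F.sub t₀.castSucc).submoduleOf (F.sub t₀.succ) ≤
      LinearMap.ker (T.mkQ.comp (F.sub t₀.succ).subtype) := fun y hy =>
    (Submodule.Quotient.mk_eq_zero T).2 (hlow _ le_rfl hy)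
  -- There are surjections `σ : Δ(l) → P(l)/T` and `π : P(l)/T → Δ(l)`. The composite is a
  -- surjective endomorphism of a Noetherian module, hence injective, which makes `π` injective too.
  let σ : Std K e l →ₗ[A] (proj e l ⧸ T) := (Submodule.liftQ _ _ hkill).comp φ.symm.toLinearMap
  have hσ : Function.Surjective σ := by
    refine Function.Surjective.comp (g := Submodule.liftQ _ _ hkill) (fun q => ?_) φ.symm.surjective
    obtain ⟨p, rfl⟩ := T.mkQ_surjective q
    obtain ⟨y, hy, z, hz, rfl⟩ := Submodule.mem_sup.1 (htop ▸ Submodule.mem_top : p ∈ _ ⊔ T)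
    have hz' : T.mkQ z = 0 := (Submodule.Quotient.mk_eq_zero T).2 hz
    refine ⟨Submodule.mkQ _ ⟨y, hy⟩, ?_⟩
    rw [Submodule.mkQ_apply, Submodule.liftQ_apply, map_add, hz', add_zero]
    rfl
  let π : (proj e l ⧸ T) →ₗ[A] Std K e l := Submodule.factor hTle
  have hπ : Function.Surjective π := Submodule.factor_surjective hTle
  have hfin := finite_proj_quotient (K := K) l (stdKer K e l)
  have hnoeth : IsNoetherian A (Std K e l) := isNoetherian_of_tower K inferInstance
  have hinj : Function.Injective (π.comp σ) :=
    IsNoetherian.injective_of_surjective_endomorphism _ (hπ.comp hσ)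
  intro x hx
  obtain ⟨z, hz⟩ := hσ (T.mkQ x)
  have h0 : π.comp σ z = 0 := by
    rw [LinearMap.comp_apply, hz]
    exact (Submodule.Quotient.mk_eq_zero _).2 hx
  rw [← map_zero (π.comp σ)] at h0
  rw [hinj h0, map_zero] at hz
  exact (Submodule.Quotient.mk_eq_zero _).1 hz.symm

/-- If `l ∉ U`, no `u ∈ U` is below `l`, so `e u` sends `N` into `N'`. If `l ∈ U`, then modulo the
trace of `N'` the trace of `N` lies in the span of the generator `x` of `Δ(l)`. A multiple `c • x`
in `N'` has `c • e l` in `stdKer`, which lies in the trace of the `P(u)` with `u > l`; these `u` lie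
in `U` and send `x` into `N'`. -/
theorem IsQuasiHereditary.trace_inf_le [FiniteDimensional K A]
    (hid : ∀ k, IsIdempotentElem (e k)) (hA : IsQuasiHereditary K e) {l : Q}
    {N N' : Submodule A V} (h : Nonempty (SubQuot N N' ≃ₗ[A] Std K e l)) {U : Set Q}
    (hU : IsUpperSet U) : trace e U N ⊓ N' ≤ trace e U N' := by
  have hmem : ∀ u ∈ U, ¬ u ≤ l → ∀ y ∈ N, e u • y ∈ trace e U N' := fun u hu hul y hy => by
    rw [← hid u, mul_smul]
    exact smul_mem_trace e hu (smul_mem_of_not_le h hul hy)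
  by_cases hl : l ∈ U
  · obtain ⟨x, hx, hlx, hgen, hker⟩ := exists_gen_of_subQuot_equiv (hid l) h
    have hle : trace e U N ≤ trace e U N' ⊔ Submodule.span A {x} := by
      refine trace_le_iff.2 fun u hu y hy => ?_
      obtain ⟨a, ha⟩ := hgen y hy
      rw [← sub_add_cancel y (a • x), smul_add, ← mul_smul]
      exact Submodule.add_mem_sup (smul_mem_trace e hu ha)
        (Submodule.smul_mem _ _ (Submodule.mem_span_singleton_self x))
    rintro y ⟨hy, hyN'⟩
    obtain ⟨w, hw, z, hz, rfl⟩ := Submodule.mem_sup.1 (hle hy)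
    obtain ⟨c, rfl⟩ := Submodule.mem_span_singleton.1 hz
    refine add_mem hw ?_
    have hcx : c • x ∈ N' := (N'.add_mem_iff_right (trace_le e U N' hw)).1 hyN'
    have hc := hA.stdKer_le_trace hid l (hker c hcx)
    let g : proj e l →ₗ[A] V := (LinearMap.toSpanSingleton A V x).comp (proj e l).subtype
    have hg : c • x = g (c • projGen e l) := by
      change c • x = (c * e l) • x
      rw [mul_smul, hlx]
    have hmap : trace e (Set.Ioi l) ⊤ ≤ (trace e U N').comap g :=
      trace_le_iff.2 fun u hu p _ => by
        rw [Submodule.mem_comap, map_smul]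
        exact hmem u (hU (le_of_lt hu) hl) (not_le_of_gt hu) _ (N.smul_mem _ hx)
    rw [hg]
    exact hmap hc
  · refine inf_le_left.trans (trace_le_iff.2 fun u hu y hy => hmem u hu (fun hul => ?_) y hy)
    exact hl (hU hul hu)

/-- If `Δ(i)` occurs in a `Δ`-good filtration, then `S(i)` occurs in the quotient by the trace of
the `P(u)` with `u ≰ i`. -/
theorem IsQuasiHereditary.exists_notMem_trace [FiniteDimensional K A]
    (hid : ∀ k, IsIdempotentElem (e k)) (hA : IsQuasiHereditary K e)
    (F : StdFiltration K e V) (t₀ : Fin F.length) :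
    ∃ y : V, e (F.label t₀) • y ∉ trace e {u | ¬ u ≤ F.label t₀} (⊤ : Submodule A V) := by
  set i := F.label t₀
  set U : Set Q := {u | ¬ u ≤ i}
  have hU : IsUpperSet U := fun a b hab ha hb => ha (hab.trans hb)
  -- At `s = t₀.succ` this says that `e u` kills `Δ(i)` for `u ≰ i`; `trace_inf_le` carries it up
  -- the filtration to all of `V`.
  have key : ∀ s : Fin (F.length + 1), t₀.succ ≤ s →
      trace e U (F.sub s) ⊓ F.sub t₀.succ ≤ F.sub t₀.castSucc := by
    intro s
    induction s using Fin.induction with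
    | zero => exact fun h => ((Fin.succ_pos t₀).not_ge h).elim
    | succ k ih =>
      intro hk
      rcases eq_or_ne k t₀ with rfl | hne
      · exact inf_le_left.trans (trace_le_iff.2 fun u hu y hy =>
          smul_mem_of_not_le (F.factor k) hu hy)
      · have hk' : t₀ < k := lt_of_le_of_ne (Fin.succ_le_succ_iff.1 hk) hne.symm
        have hk'' : t₀.succ ≤ k.castSucc := Fin.succ_le_castSucc_iff.2 hk'
        refine le_trans (le_inf ?_ inf_le_right) (ih hk'')
        refine le_trans (le_inf inf_le_left (inf_le_right.trans (F.monotone hk''))) ?_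
        exact hA.trace_inf_le hid (F.factor k) hU
  obtain ⟨ψ, hψ, hker⟩ := exists_map_of_subQuot_equiv (F.factor t₀)
  obtain ⟨z, hz⟩ := exists_smul_ne_zero_of_mult_eq_one (hA.std_self i)
  obtain ⟨y, rfl⟩ := hψ z
  refine ⟨y, fun hy => hz ?_⟩
  rw [← map_smul, hker]
  refine key (Fin.last _) (Fin.le_last _) ⟨?_, Submodule.smul_mem _ _ y.2⟩
  rw [F.sub_last]
  exact hy

/-- If `Δ(n)`, `n` the largest vertex, occurs once in a `Δ`-good filtration of `M`, then
`e n • M` is at most one-dimensional. -/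
theorem StdFiltration.exists_smul_eq [FiniteDimensional K A] [OrderTop Q] [Module K V]
    [IsScalarTower K A V] (hid : ∀ k, IsIdempotentElem (e k)) (hA : IsQuasiHereditary K e)
    (F : StdFiltration K e V) (hF : F.count ⊤ = 1) (x y : V) (hx : e ⊤ • x ≠ 0) :
    ∃ c : K, c • e ⊤ • x = e ⊤ • y := by
  obtain ⟨t₀, ht₀, huniq⟩ := F.exists_label_eq hF
  have hidem : ∀ z : V, e ⊤ • e ⊤ • z = e ⊤ • z := fun z => by rw [← mul_smul, hid]
  -- As `⊤ ≰ l` for `l ≠ ⊤`, only the factor at `t₀` contributes to `e ⊤ • V`.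
  have hstep : ∀ t, t ≠ t₀ → ∀ z ∈ F.sub t.succ, e ⊤ • z ∈ F.sub t.castSucc :=
    fun t ht z hz => smul_mem_of_not_le (F.factor t)
      (fun h => ht (huniq t (top_le_iff.1 h))) hz
  have hlow : ∀ s : Fin (F.length + 1), s ≤ t₀.castSucc → ∀ z ∈ F.sub s, e ⊤ • z = 0 := by
    intro s
    induction s using Fin.induction with
    | zero =>
      intro _ z hz
      rw [F.sub_zero, Submodule.mem_bot] at hz
      rw [hz, smul_zero]
    | succ i ih =>
      intro hi z hz
      have hi' : i < t₀ := Fin.succ_le_castSucc_iff.1 hi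
      rw [← hidem]
      exact ih (Fin.castSucc_le_castSucc_iff.2 hi'.le) _ (hstep i hi'.ne z hz)
  have hhigh : ∀ s : Fin (F.length + 1), t₀.succ ≤ s → ∀ z ∈ F.sub s, e ⊤ • z ∈ F.sub t₀.succ := by
    intro s
    induction s using Fin.induction with
    | zero => exact fun h => ((Fin.succ_pos t₀).not_ge h).elim
    | succ i ih =>
      intro hi z hz
      rcases eq_or_ne i t₀ with rfl | hne
      · exact Submodule.smul_mem _ _ hz
      · have hi' : t₀ < i := lt_of_le_of_ne (Fin.succ_le_succ_iff.1 hi) hne.symm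
        rw [← hidem]
        exact ih (Fin.succ_le_castSucc_iff.2 hi') _ (hstep i hne z hz)
  have hmem : ∀ z : V, e ⊤ • z ∈ F.sub t₀.succ := fun z =>
    hhigh (Fin.last _) (Fin.le_last _) z (F.sub_last ▸ Submodule.mem_top)
  have hfac := F.factor t₀
  rw [ht₀] at hfac
  obtain ⟨ψ, -, hker⟩ := exists_map_of_subQuot_equiv hfac
  let x' : F.sub t₀.succ := ⟨e ⊤ • x, hmem x⟩
  let y' : F.sub t₀.succ := ⟨e ⊤ • y, hmem y⟩
  have hx' : e ⊤ • x' = x' := Subtype.ext (hidem x)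
  have hy' : e ⊤ • y' = y' := Subtype.ext (hidem y)
  have hne : e ⊤ • ψ x' ≠ 0 := by
    rw [← map_smul, hx', Ne, hker]
    intro h
    exact hx ((hidem x).symm.trans (hlow _ le_rfl _ h))
  obtain ⟨c, hc⟩ := exists_smul_eq_of_mult_eq_one (hA.std_self ⊤) (ψ x') (ψ y') hne
  rw [← map_smul ψ (e ⊤) x', ← map_smul ψ (e ⊤) y', hx', hy', ← algebraMap_smul A c, ← map_smul, ← sub_eq_zero,
    ← map_sub, hker] at hc
  -- The difference lies in `F.sub t₀.castSucc`, where `e ⊤` acts as zero, yet `e ⊤` fixes it.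
  have h0 := hlow _ le_rfl _ hc
  refine ⟨c, sub_eq_zero.1 (Eq.trans ?_ h0)⟩
  change c • e ⊤ • x - e ⊤ • y = e ⊤ • (algebraMap K A c • e ⊤ • x - e ⊤ • y)
  rw [smul_sub, hidem, algebraMap_smul, smul_comm (e ⊤) c, hidem]

end Std

/-! ### Thinness and supports under homomorphisms -/

section Thin

variable {A Q : Type*} [Ring A] {e : Q → A} {M : Type*} [AddCommGroup M] [Module A M]

theorem isThin_of_field {K : Type*} [Field K] [Algebra K A] [Module K M] [IsScalarTower K A M]
    (h : ∀ k (x y : M), e k • x ≠ 0 → ∃ c : K, c • e k • x = e k • y) : IsThin e M :=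
  fun k x y hx => by
    obtain ⟨c, hc⟩ := h k x y hx
    exact ⟨algebraMap K A c, by rw [algebraMap_smul, hc]⟩

theorem supp_range_of_injective {N : Type*} [AddCommGroup N] [Module A N] {f : M →ₗ[A] N} (hf : Function.Injective f) :
    supp e (LinearMap.range f) = {k | ∃ x : M, e k • x ≠ 0} := by
  ext k
  constructor
  · rintro ⟨_, ⟨x, rfl⟩, hx⟩
    exact ⟨x, fun h => hx (by rw [← map_smul, h, map_zero])⟩
  · rintro ⟨x, hx⟩
    exact ⟨f x, ⟨x, rfl⟩, fun h => hx (hf (by rw [map_smul, h, map_zero]))⟩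

theorem IsThin.of_surjective {N : Type*} [AddCommGroup N] [Module A N] (h : IsThin e M) {p : M →ₗ[A] N} (hp : Function.Surjective p) : IsThin e N := by
  intro k x y hx
  obtain ⟨x, rfl⟩ := hp x
  obtain ⟨y, rfl⟩ := hp y
  obtain ⟨a, ha⟩ := h k x y fun h0 => hx (by rw [← map_smul, h0, map_zero])
  exact ⟨a, by rw [← map_smul, ← map_smul, ha, map_smul]⟩

end Thin

/-! ### Submodules of standard modules -/

section StdLattice

variable {K A Q : Type*} [Field K] [Ring A] [Algebra K A] [FiniteDimensional K A] {e : Q → A}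
  [PartialOrder Q] [BoundedOrder Q]

theorem IsOneQuasiHereditary.exists_smul_std_ne_zero_iff (hA : IsOneQuasiHereditary K e)
    (i k : Q) : (∃ x : Std K e i, e k • x ≠ 0) ↔ k ≤ i := by
  constructor
  · rintro ⟨x, hx⟩
    by_contra hk
    exact hx (smul_std_eq_zero hk x)
  · exact fun hk => exists_smul_ne_zero_of_mult_eq_one (hA.std_mult i k hk)

theorem IsOneQuasiHereditary.isThin_std (hA : IsOneQuasiHereditary K e) (i : Q) :
    IsThin e (Std K e i) :=
  isThin_of_field (K := K) fun k x y hx => exists_smul_eq_of_mult_eq_one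
    (hA.std_mult i k ((hA.exists_smul_std_ne_zero_iff i k).1 ⟨x, hx⟩)) x y hx

theorem IsOneQuasiHereditary.supp_range_std (hA : IsOneQuasiHereditary K e) {i : Q}
    {M : Type*} [AddCommGroup M] [Module A M] {f : Std K e i →ₗ[A] M}
    (hf : Function.Injective f) : supp e (LinearMap.range f) = Set.Iic i :=
  (supp_range_of_injective hf).trans (Set.ext fun k => hA.exists_smul_std_ne_zero_iff i k)

/-- Both modules embed in `Δ(n)`, where comparing supports puts the image of `Δ(i)` inside that of
`Δ(j)`. -/
theorem IsOneQuasiHereditary.exists_std_embedding [Fintype Q]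
    (he : CompleteOrthogonalIdempotents e) (hA : IsOneQuasiHereditary K e) {i j : Q} (hij : i ≤ j) :
    ∃ f : Std K e i →ₗ[A] Std K e j, Function.Injective f := by
  obtain ⟨f, hf⟩ := hA.std_embeds i
  obtain ⟨g, hg⟩ := hA.std_embeds j
  have hle : LinearMap.range f ≤ LinearMap.range g := by
    rw [(hA.isThin_std ⊤).le_iff he, hA.supp_range_std hf, hA.supp_range_std hg]
    exact Set.Iic_subset_Iic.2 hij
  refine ⟨(LinearEquiv.ofInjective g hg).symm.toLinearMap.comp
    (f.codRestrict (LinearMap.range g) fun x => hle ⟨x, rfl⟩), ?_⟩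
  exact (LinearEquiv.ofInjective g hg).symm.injective.comp
    (fun x y h => hf (congrArg Subtype.val h))

/-- The copy of `Δ(k)` in `Δ(j)` contains `e k • Δ(j)` and has support `Set.Iic k`, so only vertices
below `k` are reached from `k`. All of them are, since `e k` fixes a generator of `Δ(k)`. -/
theorem IsOneQuasiHereditary.isOrderedThin_std [Fintype Q]
    (he : CompleteOrthogonalIdempotents e) (hA : IsOneQuasiHereditary K e) (j : Q) :
    IsOrderedThin e (Std K e j) (Set.Iic j) := by
  have hthin := hA.isThin_std j
  have hgen : ∀ k ≤ j, ∃ f : Std K e k →ₗ[A] Std K e j, Function.Injective f ∧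
      ∀ x : Std K e j, e k • x ∈ LinearMap.range f := fun k hk => by
    obtain ⟨f, hf⟩ := hA.exists_std_embedding he hk
    exact ⟨f, hf, hthin.smul_mem (by rw [hA.supp_range_std hf]; exact Set.mem_Iic.2 le_rfl)⟩
  refine ⟨hthin, fun m k => ⟨?_, ?_⟩⟩
  · rintro ⟨a, x, hx⟩
    have hk : k ≤ j := (hA.exists_smul_std_ne_zero_iff j k).1
      ⟨x, fun h => hx (by rw [h, smul_zero, smul_zero])⟩
    obtain ⟨f, hf, hmem⟩ := hgen k hk
    have hmk : m ≤ k := by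
      have : m ∈ supp e (LinearMap.range f) := ⟨_, Submodule.smul_mem _ a (hmem x), hx⟩
      rwa [hA.supp_range_std hf] at this
    exact ⟨hmk.trans hk, hk, hmk⟩
  · rintro ⟨-, hk, hmk⟩
    obtain ⟨f, hf, -⟩ := hgen k hk
    obtain ⟨y, hy⟩ := (hA.exists_smul_std_ne_zero_iff k m).2 hmk
    obtain ⟨a, rfl⟩ := exists_smul_stdGen (he.idem k) y
    refine ⟨a, f (stdGen K e k), fun h => hy (hf ?_)⟩
    rw [map_zero, ← h, ← map_smul f (e k), smul_stdGen (he.idem k), map_smul, map_smul]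

end StdLattice

/-! ### Submodules of costandard modules -/

section Costd

variable {K A Q : Type*} [Field K] [Ring A] [Algebra K A] {e : Q → A}

theorem finite_submodule_coReg [FiniteDimensional K A] (N : Submodule A (CoReg K A)) :
    Module.Finite K N := by
  have : Module.Finite K (CoReg K A) := inferInstanceAs (Module.Finite K (A →ₗ[K] K))
  exact inferInstanceAs (Module.Finite K (N.restrictScalars K))

/-- Dual to `e i` generating `P(i)`: the value of `e i • x • f` at `1` is `f (e i * x) = f x`. -/
theorem exists_smul_ne_zero_of_mem_inj {i : Q} {f : CoReg K A} (hf : f ∈ inj K e i) (h0 : f ≠ 0) :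
    ∃ a : A, e i • a • f ≠ 0 := by
  by_contra! h
  refine h0 (CoReg.ext fun x => ?_)
  have h1 := DFunLike.congr_fun (h x) (1 : A)
  rw [CoReg.smul_apply, CoReg.smul_apply, one_mul, hf x] at h1
  exact h1

variable [PartialOrder Q]

/-- The conditions on the right cut out a submodule that itself belongs to the family defining
`costd`, so the supremum is attained. -/
theorem mem_costd_iff [FiniteDimensional K A] {i : Q} {f : CoReg K A} :
    f ∈ costd K e i ↔ f ∈ inj K e i ∧ ∀ u, ¬ u ≤ i → ∀ a : A, e u • a • f = 0 := by
  let C : Submodule A (CoReg K A) :=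
    { carrier := {f | f ∈ inj K e i ∧ ∀ u, ¬ u ≤ i → ∀ a : A, e u • a • f = 0}
      add_mem' := fun {f g} hf hg => ⟨add_mem hf.1 hg.1, fun u hu a => by
        rw [smul_add, smul_add, hf.2 u hu a, hg.2 u hu a, add_zero]⟩
      zero_mem' := ⟨zero_mem _, fun u _ a => by rw [smul_zero, smul_zero]⟩
      smul_mem' := fun b f hf => ⟨Submodule.smul_mem _ b hf.1, fun u hu a => by
        rw [← mul_smul a b]; exact hf.2 u hu (a * b)⟩ }
  have hC : costd K e i = C := by
    refine le_antisymm (sSup_le ?_) (le_sSup ⟨fun f hf => hf.1, fun u hu => ?_⟩)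
    · rintro N ⟨hN, hmult⟩ f hf
      refine ⟨hN hf, fun u hu a => ?_⟩
      have := finite_submodule_coReg N
      exact congrArg Subtype.val (mult_eq_zero_iff.1 (hmult u hu) (a • ⟨f, hf⟩))
    · have := finite_submodule_coReg C
      refine mult_eq_zero_iff.2 fun f => Subtype.ext ?_
      have := f.2.2 u hu 1
      rwa [one_smul] at this
  rw [hC]
  rfl

theorem smul_costd_eq_zero [FiniteDimensional K A] {i u : Q} (hu : ¬ u ≤ i) (f : costd K e i) :
    e u • f = 0 := by
  have := (mem_costd_iff.1 f.2).2 u hu 1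
  rw [one_smul] at this
  exact Subtype.ext this

theorem exists_smul_ne_zero_of_costd [FiniteDimensional K A] {i : Q} (f : costd K e i)
    (h0 : f ≠ 0) : ∃ a : A, e i • a • f ≠ 0 := by
  obtain ⟨a, ha⟩ := exists_smul_ne_zero_of_mem_inj (mem_costd_iff.1 f.2).1
    (fun h => h0 (Subtype.ext h))
  exact ⟨a, fun h => ha (congrArg Subtype.val h)⟩

variable [FiniteDimensional K A] [BoundedOrder Q]

/-- The nonvanishing half of BGG reciprocity: an occurrence of `Δ(i)` in `P(k)` yields `e i • y`
outside the trace `T` of the `P(u)` with `u ≰ i`, and a functional that separates it from `T` gives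
an element of `∇(i)`. -/
theorem IsOneQuasiHereditary.exists_smul_costd_ne_zero_iff (hid : ∀ k, IsIdempotentElem (e k))
    (hA : IsOneQuasiHereditary K e) (i k : Q) :
    (∃ f : costd K e i, e k • f ≠ 0) ↔ k ≤ i := by
  constructor
  · rintro ⟨f, hf⟩
    by_contra hk
    exact hf (smul_costd_eq_zero hk f)
  · intro hk
    obtain ⟨F, hF⟩ := hA.proj_mult i k hk
    obtain ⟨t₀, ht₀, -⟩ := F.exists_label_eq hF
    obtain ⟨y, hy⟩ := hA.exists_notMem_trace hid F t₀
    rw [ht₀] at hy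
    set T := trace e {u | ¬ u ≤ i} (⊤ : Submodule A (proj e k))
    obtain ⟨h, hh0, hhT⟩ := Submodule.exists_le_ker_of_notMem (p := T.restrictScalars K) hy
    let ρ : A →ₗ[K] proj e k :=
      (LinearMap.toSpanSingleton A (proj e k) (projGen e k)).restrictScalars K
    -- That is, `g x = h (e i * x * e k)`: the factor `e i` puts `g` in `I(i)`, vanishing of `h` on
    -- `T` puts it in `∇(i)`, and `(e k • g) y = h (e i • y) ≠ 0`.
    let g : CoReg K A := (h.comp ρ).comp (LinearMap.mulLeft K (e i))
    have hg : ∀ x, g x = h ((e i * x) • projGen e k) := fun x => rfl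
    have hginj : g ∈ inj K e i := fun x => by rw [hg, hg, ← mul_assoc, hid]
    have hgmem : g ∈ costd K e i := by
      refine mem_costd_iff.2 ⟨hginj, fun u hu a => CoReg.ext fun x => ?_⟩
      rw [CoReg.smul_apply, CoReg.smul_apply, hg, CoReg.zero_apply]
      refine hhT (Submodule.restrictScalars_mem K T _ |>.2 ?_)
      rw [mul_smul, mul_smul, mul_smul]
      exact T.smul_mem _ (T.smul_mem _ (smul_mem_trace e hu Submodule.mem_top))
    refine ⟨⟨g, hgmem⟩, fun h0 => hh0 ?_⟩
    have h1 : (e k • g) y.1 = 0 := DFunLike.congr_fun (congrArg Subtype.val h0) y.1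
    rwa [CoReg.smul_apply, hg, smul_eq_self_of_mem_span (hid k) y.2, mul_smul,
      coe_smul_projGen (hid k)] at h1

/-- For `f ∈ ∇(n)`, `e k • f` depends only on the values of `f` on `e n • P(k)`, which is at most
one-dimensional because `Δ(n)` occurs once in `P(k)`. -/
theorem IsOneQuasiHereditary.isThin_costd_top (hid : ∀ k, IsIdempotentElem (e k))
    (hA : IsOneQuasiHereditary K e) : IsThin e (costd K e (⊤ : Q)) := by
  refine isThin_of_field (K := K) fun k f g hf => ?_
  obtain ⟨F, hF⟩ := hA.proj_mult ⊤ k le_top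
  have hline := F.exists_smul_eq hid hA.toIsQuasiHereditary hF
  have hval : ∀ (f : costd K e (⊤ : Q)) (y : A),
      (e k • f.1) y = f.1 (e ⊤ • y • projGen e k : proj e k).1 := fun f y => by
    rw [CoReg.smul_apply, ← (mem_costd_iff.1 f.2).1]
    rfl
  have hne : ∃ y, (e k • f.1) y ≠ 0 := by
    by_contra! h
    exact hf (Subtype.ext (CoReg.ext h))
  obtain ⟨y, hy⟩ := hne
  refine ⟨(e k • g.1) y / (e k • f.1) y, Subtype.ext (CoReg.ext fun x => ?_)⟩
  have hy' : e ⊤ • y • projGen e k ≠ 0 := fun h => hy (by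
    rw [hval, h]; exact CoReg.map_zero _)
  obtain ⟨c, hc⟩ := hline (y • projGen e k) (x • projGen e k) hy'
  -- The scalar `c` depends on `x` and `y` but not on the functional.
  have hcx : ∀ f : costd K e (⊤ : Q), (e k • f.1) x = c * (e k • f.1) y := fun f => by
    rw [hval, hval, ← hc]
    exact CoReg.map_smul _ _ _
  change _ * (e k • f.1) x = (e k • g.1) x
  rw [hcx, hcx]
  field_simp

/-- By thinness `p` kills all of `e k • ∇(n)` or none of its nonzero vectors. The support does not
involve `p`, hence neither does the kernel. -/
theorem IsOneQuasiHereditary.supp_ker_costd (hid : ∀ k, IsIdempotentElem (e k))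
    (hA : IsOneQuasiHereditary K e) {i : Q} {p : costd K e (⊤ : Q) →ₗ[A] costd K e i}
    (hp : Function.Surjective p) : supp e (LinearMap.ker p) = {k | ¬ k ≤ i} := by
  ext k
  constructor
  · intro hk hki
    obtain ⟨f, hf⟩ := (hA.exists_smul_costd_ne_zero_iff hid i k).2 hki
    obtain ⟨g, rfl⟩ := hp f
    rw [← map_smul] at hf
    exact hf ((hA.isThin_costd_top hid).smul_mem hk g)
  · intro hk
    obtain ⟨f, hf⟩ := (hA.exists_smul_costd_ne_zero_iff hid ⊤ k).2 le_top
    refine ⟨e k • f, ?_, by rwa [← mul_smul, hid]⟩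
    rw [LinearMap.mem_ker, map_smul]
    exact smul_costd_eq_zero hk _

/-- If `k ≰ m`, the kernel of `∇(n) → ∇(m)` contains `e k • ∇(n)` but is zero at `m`, so `m` is not
reached. If `k ≤ m`, every nonzero vector of `∇(m)` reaches `m`; this is lifted to `∇(n)` and
survives in `∇(j)`, as the kernel there is zero at `m ≤ j`. -/
theorem IsOneQuasiHereditary.reach_costd_iff (hid : ∀ k, IsIdempotentElem (e k))
    (hA : IsOneQuasiHereditary K e) (j m k : Q) :
    (∃ (a : A) (f : costd K e j), e m • a • e k • f ≠ 0) ↔ m ≤ j ∧ k ≤ j ∧ k ≤ m := by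
  have hthin := hA.isThin_costd_top hid
  obtain ⟨p, hp⟩ := hA.costd_covers j
  constructor
  · rintro ⟨a, f, hf⟩
    have hk : k ≤ j := (hA.exists_smul_costd_ne_zero_iff hid j k).1
      ⟨f, fun h => hf (by rw [h, smul_zero, smul_zero])⟩
    have hm : m ≤ j := (hA.exists_smul_costd_ne_zero_iff hid j m).1 ⟨_, hf⟩
    refine ⟨hm, hk, ?_⟩
    by_contra hkm
    obtain ⟨q, hq⟩ := hA.costd_covers m
    obtain ⟨g, rfl⟩ := hp f
    have hmem : a • e k • g ∈ LinearMap.ker q := by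
      refine Submodule.smul_mem _ _ (hthin.smul_mem ?_ g)
      rw [hA.supp_ker_costd hid hq]
      exact hkm
    have hsupp : m ∈ supp e (LinearMap.ker q) := ⟨_, hmem, fun h => hf (by
      rw [← map_smul p (e k), ← map_smul, ← map_smul, h, map_zero])⟩
    rw [hA.supp_ker_costd hid hq] at hsupp
    exact hsupp le_rfl
  · rintro ⟨hm, -, hkm⟩
    obtain ⟨q, hq⟩ := hA.costd_covers m
    obtain ⟨f, hf⟩ := (hA.exists_smul_costd_ne_zero_iff hid m k).2 hkm
    obtain ⟨a, ha⟩ := exists_smul_ne_zero_of_costd _ hf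
    obtain ⟨g, rfl⟩ := hq f
    refine ⟨a, p g, fun h => ?_⟩
    have hmem : e m • a • e k • g ∈ LinearMap.ker p := by
      rw [LinearMap.mem_ker, map_smul, map_smul, map_smul, h]
    have hsupp : m ∈ supp e (LinearMap.ker p) := by
      refine ⟨_, hmem, fun h0 => ha ?_⟩
      rw [← mul_smul, hid] at h0
      rw [← map_smul q, ← map_smul q, ← map_smul q, h0, map_zero]
    rw [hA.supp_ker_costd hid hp] at hsupp
    exact hsupp hm

/-- Reachability runs upwards here, so the general theory is applied to the opposite order. -/
theorem IsOneQuasiHereditary.isOrderedThin_costd (hid : ∀ k, IsIdempotentElem (e k))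
    (hA : IsOneQuasiHereditary K e) (j : Q) :
    IsOrderedThin (fun k : Qᵒᵈ => e (OrderDual.ofDual k)) (costd K e j)
      (OrderDual.ofDual ⁻¹' Set.Iic j) := by
  obtain ⟨p, hp⟩ := hA.costd_covers j
  exact ⟨fun k => (hA.isThin_costd_top hid).of_surjective hp (OrderDual.ofDual k),
    fun m k => hA.reach_costd_iff hid j (OrderDual.ofDual m) (OrderDual.ofDual k)⟩

theorem IsOneQuasiHereditary.supp_map_costd (hid : ∀ k, IsIdempotentElem (e k))
    (hA : IsOneQuasiHereditary K e) {j : Q} {p : costd K e (⊤ : Q) →ₗ[A] costd K e j}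
    (hp : Function.Surjective p) (N : Submodule A (costd K e (⊤ : Q))) :
    supp e (N.map p) = supp e N ∩ Set.Iic j := by
  have hthin := hA.isThin_costd_top hid
  ext k
  constructor
  · rintro ⟨_, ⟨x, hx, rfl⟩, hne⟩
    refine ⟨⟨x, hx, fun h => hne (by rw [← map_smul, h, map_zero])⟩, ?_⟩
    exact (hA.exists_smul_costd_ne_zero_iff hid j k).1 ⟨_, hne⟩
  · rintro ⟨hkN, hkj⟩
    obtain ⟨y, hy⟩ := (hA.exists_smul_costd_ne_zero_iff hid j k).2 hkj
    obtain ⟨z, rfl⟩ := hp y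
    refine ⟨p (e k • z), ⟨_, hthin.smul_mem hkN z, rfl⟩, ?_⟩
    rwa [← map_smul, ← mul_smul, hid, map_smul]

end Costd

/-! ### Initial segments and reversal of sequences -/

section Sequences

variable {Q : Type*} [PartialOrder Q] [Finite Q] {j : Q}

/-- Initial segments are lower sets. The left side is the support of a sum of `Δ(s m)`, and its
negation describes an intersection of kernels. -/
theorem forall_le_of_initialSet (s : Seqs j) (t : ℕ) {q : Q} :
    (∃ m : Fin _, m.val < t ∧ q ≤ s.1 m) ↔ q ∈ initialSet s.1 t := by
  have hinj := injective_of_forall_not_le s.2.2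
  constructor
  · rintro ⟨m, hm, hq⟩
    obtain ⟨k, rfl⟩ := exists_eq_of_card (Λ := Set.Iic j) rfl hinj s.2.1 (hq.trans (s.2.1 m))
    refine ⟨k, lt_of_le_of_lt ?_ hm, rfl⟩
    by_contra! hk
    exact s.2.2 m k hk hq
  · rintro ⟨m, hm, rfl⟩
    exact ⟨m, hm, le_rfl⟩

/-- Reversing a sequence turns linear extensions into those of the opposite order. -/
noncomputable def seqsRev (j : Q) : Seqs j ≃ {s : Fin (Nat.card (Set.Iic j)) → Qᵒᵈ //
    (∀ m, s m ∈ OrderDual.ofDual ⁻¹' Set.Iic j) ∧ ∀ k t, k < t → ¬ s t ≤ s k} where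
  toFun s := ⟨fun m => OrderDual.toDual (s.1 m.rev), fun m => s.2.1 m.rev,
    fun _ _ hkt => s.2.2 _ _ (Fin.rev_lt_rev.2 hkt)⟩
  invFun s := ⟨fun m => OrderDual.ofDual (s.1 m.rev), fun m => s.2.1 m.rev,
    fun _ _ hkt => s.2.2 _ _ (Fin.rev_lt_rev.2 hkt)⟩
  left_inv s := Subtype.ext (funext fun m => congrArg s.1 m.rev_rev)
  right_inv s := Subtype.ext (funext fun m => congrArg s.1 m.rev_rev)

/-- The first `u` entries of the reversed sequence are the last `u` of the original one. -/
theorem initialSet_seqsRev (s : Seqs j) {t u : ℕ} (htu : u + t = Nat.card (Set.Iic j)) :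
    initialSet (seqsRev j s).1 u = OrderDual.ofDual ⁻¹' (Set.Iic j \ initialSet s.1 t) := by
  have hinj := injective_of_forall_not_le s.2.2
  ext q
  constructor
  · rintro ⟨m, hm, rfl⟩
    refine ⟨s.2.1 m.rev, ?_⟩
    rintro ⟨k, hk, hkm⟩
    have := hinj hkm
    subst this
    rw [Fin.val_rev] at hk
    omega
  · rintro ⟨hq, hnot⟩
    obtain ⟨k, hk⟩ := exists_eq_of_card (Λ := Set.Iic j) rfl hinj s.2.1 hq
    refine ⟨k.rev, ?_, (congrArg s.1 k.rev_rev).trans hk⟩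
    have : ¬ k.val < t := fun h => hnot ⟨k, h, hk⟩
    rw [Fin.val_rev]
    omega

end Sequences

/-! ### The two families of Jordan–Hölder filtrations -/

/-- The Jordan–Hölder filtrations of a standard module. -/
theorem IsOneQuasiHereditary.jhFiltration_std {K A Q : Type*} [Field K] [Ring A] [Algebra K A]
    [FiniteDimensional K A] [Fintype Q] [PartialOrder Q] [BoundedOrder Q] {e : Q → A}
    (he : IsBasicSystem e) (hA : IsOneQuasiHereditary K e) (j : Q) :
    ∃ D : Q → Submodule A (Std K e j),
      (∀ i, i ≤ j →
        (∃ f : Std K e i →ₗ[A] Std K e j, Function.Injective f) ∧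
        ∀ f : Std K e i →ₗ[A] Std K e j, Function.Injective f → LinearMap.range f = D i) ∧
      ∃ 𝒮 : Seqs j → JHFiltration A (Std K e j),
        Function.Bijective 𝒮 ∧
        ∀ s : Seqs j,
          (𝒮 s).1.length = Nat.card (Set.Iic j) ∧
          (∀ t : Fin ((𝒮 s).1.length + 1), (𝒮 s).1 t = partialSum D s.1 t.val) ∧
          ∀ m : Fin (Nat.card (Set.Iic j)), Nonempty
            (SubQuot (partialSum D s.1 (m.val + 1)) (partialSum D s.1 m.val)
              ≃ₗ[A] Simp e (s.1 m)) := by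
  have : IsArtinianRing A := IsArtinianRing.of_finite K A
  have hord := hA.isOrderedThin_std he.complete j
  have hex : ∀ i, ∃ D : Submodule A (Std K e j), i ≤ j → supp e D = Set.Iic i := fun i => by
    by_cases hi : i ≤ j
    · obtain ⟨f, hf⟩ := hA.exists_std_embedding he.complete hi
      exact ⟨_, fun _ => hA.supp_range_std hf⟩
    -- An arbitrary value: entries of a sequence in `Seqs j` never leave `Set.Iic j`.
    · exact ⟨⊥, fun h => (hi h).elim⟩
  choose D hD using hex
  have hsum : ∀ (s : Seqs j) (t : ℕ), supp e (partialSum D s.1 t) = initialSet s.1 t := by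
    intro s t
    ext q
    rw [partialSum, mem_supp_iSup, ← forall_le_of_initialSet]
    refine exists_congr fun m => ?_
    rw [mem_supp_iSup, hD _ (s.2.1 m), exists_prop]
    rfl
  obtain ⟨𝒮, h𝒮, hs⟩ := hord.exists_bijective he.complete he.primitive rfl
  refine ⟨D, fun i hi => ⟨hA.exists_std_embedding he.complete hi, fun f hf =>
    hord.thin.ext_supp he.complete ((hA.supp_range_std hf).trans (hD i hi).symm)⟩,
    𝒮, h𝒮, fun s => ⟨(hs s).1, fun t => ?_, fun m => ?_⟩⟩
  · exact hord.thin.ext_supp he.complete (((hs s).2.1 t).trans (hsum s t.val).symm)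
  · exact (hs s).2.2 m _ _ (hsum s _) (hsum s _)

/-- The Jordan–Hölder filtrations of a costandard module. -/
theorem IsOneQuasiHereditary.jhFiltration_costd {K A Q : Type*} [Field K] [Ring A]
    [Algebra K A] [FiniteDimensional K A] [Fintype Q] [PartialOrder Q] [BoundedOrder Q] {e : Q → A}
    (he : IsBasicSystem e) (hA : IsOneQuasiHereditary K e) (j : Q) :
    ∃ 𝔎 : Q → Submodule A (costd K e (⊤ : Q)),
      (∀ i,
        (∃ p : costd K e (⊤ : Q) →ₗ[A] costd K e i, Function.Surjective p) ∧
        ∀ p : costd K e (⊤ : Q) →ₗ[A] costd K e i, Function.Surjective p →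
          LinearMap.ker p = 𝔎 i) ∧
      (∀ i k, 𝔎 k ≤ 𝔎 i ↔ i ≤ k) ∧
      ∀ p : costd K e (⊤ : Q) →ₗ[A] costd K e j, Function.Surjective p →
      ∃ 𝒮' : Seqs j → JHFiltration A (costd K e j),
        Function.Bijective 𝒮' ∧
        ∀ s : Seqs j,
          (𝒮' s).1.length = Nat.card (Set.Iic j) ∧
          (∀ t : Fin ((𝒮' s).1.length + 1), (𝒮' s).1 t.rev = (partialInf 𝔎 s.1 t.val).map p) ∧
          ∀ m : Fin (Nat.card (Set.Iic j)), Nonempty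
            (SubQuot ((partialInf 𝔎 s.1 m.val).map p) ((partialInf 𝔎 s.1 (m.val + 1)).map p)
              ≃ₗ[A] Simp e (s.1 m)) := by
  have : IsArtinianRing A := IsArtinianRing.of_finite K A
  have hid := he.complete.idem
  have hthin := hA.isThin_costd_top hid
  have hord := hA.isOrderedThin_costd hid j
  choose P hP using hA.costd_covers
  have hsupp : ∀ i, supp e (LinearMap.ker (P i)) = {k | ¬ k ≤ i} :=
    fun i => hA.supp_ker_costd hid (hP i)
  refine ⟨fun i => LinearMap.ker (P i), fun i => ⟨⟨P i, hP i⟩, fun p hp =>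
    hthin.ext_supp he.complete ((hA.supp_ker_costd hid hp).trans (hsupp i).symm)⟩,
    fun i k => ?_, fun p hp => ?_⟩
  · rw [hthin.le_iff he.complete, hsupp, hsupp]
    constructor
    · intro h
      by_contra hik
      exact h hik le_rfl
    · exact fun hik l hl hli => hl (hli.trans hik)
  have hinf : ∀ (s : Seqs j) (t : ℕ),
      supp e ((partialInf (fun i => LinearMap.ker (P i)) s.1 t).map p) =
        Set.Iic j \ initialSet s.1 t := by
    intro s t
    rw [hA.supp_map_costd hid hp, Set.inter_comm]
    ext q
    refine and_congr_right fun _ => ?_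
    have htop : q ∈ supp e (⊤ : Submodule A (costd K e (⊤ : Q))) := by
      obtain ⟨x, hx⟩ := (hA.exists_smul_costd_ne_zero_iff hid ⊤ q).2 le_top
      exact ⟨x, trivial, hx⟩
    rw [partialInf, hthin.mem_supp_iInf hid, ← forall_le_of_initialSet]
    simp only [hthin.mem_supp_iInf hid, hsupp, htop, true_and, Set.mem_ofPred_eq]
    push Not
    rfl
  have hcomplete : CompleteOrthogonalIdempotents (fun k : Qᵒᵈ => e (OrderDual.ofDual k)) :=
    he.complete
  obtain ⟨𝒮, h𝒮, hs⟩ := hord.exists_bijective hcomplete (fun i => he.primitive _)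
    (r := Nat.card (Set.Iic j)) rfl
  -- The intersections descend whereas a composition series ascends, so the sequence is reversed and
  -- stage `t` sits at index `t.rev`.
  refine ⟨fun s => 𝒮 (seqsRev j s), h𝒮.comp (seqsRev j).bijective,
    fun s => ⟨(hs _).1, fun t => ?_, fun m => ?_⟩⟩
  · refine hord.thin.ext_supp hcomplete (((hs (seqsRev j s)).2.1 t.rev).trans ?_)
    rw [initialSet_seqsRev s (t := t.val)]
    · exact (hinf s t.val).symm
    · have hrev : ∀ {n : ℕ} (t : Fin (n + 1)), t.rev.val + t.val = n := fun t => by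
        rw [Fin.val_rev]
        omega
      exact (hrev t).trans (hs _).1
  · have h := (hs (seqsRev j s)).2.2 m.rev ((partialInf (fun i => LinearMap.ker (P i)) s.1 m).map p)
      ((partialInf (fun i => LinearMap.ker (P i)) s.1 (m + 1)).map p) ?_ ?_
    · have hm : (seqsRev j s).1 m.rev = OrderDual.toDual (s.1 m) :=
        congrArg (fun k => OrderDual.toDual (s.1 k)) m.rev_rev
      rw [hm] at h
      exact h
    · refine (hinf s m).trans (initialSet_seqsRev s ?_).symm
      rw [Fin.val_rev]
      omega
    · refine (hinf s (m + 1)).trans (initialSet_seqsRev s ?_).symm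
      rw [Fin.val_rev]
      omega

end OneQH

theorem mainTheorem7 {K A Q₀ : Type*} [Field K] [IsAlgClosed K] [Ring A] [Algebra K A]
    [FiniteDimensional K A] [Fintype Q₀] [PartialOrder Q₀] [BoundedOrder Q₀]
    (e : Q₀ → A) (he : OneQH.IsBasicSystem e) (hA : OneQH.IsOneQuasiHereditary K e) (j : Q₀) :
    -- (1) `D i` is the unique copy of `Δ(i)` inside `Δ(j)`
    (∃ D : Q₀ → Submodule A (OneQH.Std K e j),
      (∀ i, i ≤ j →
        (∃ f : OneQH.Std K e i →ₗ[A] OneQH.Std K e j, Function.Injective f) ∧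
        ∀ f : OneQH.Std K e i →ₗ[A] OneQH.Std K e j, Function.Injective f →
          LinearMap.range f = D i) ∧
      ∃ 𝒮 : OneQH.Seqs j → OneQH.JHFiltration A (OneQH.Std K e j),
        Function.Bijective 𝒮 ∧
        ∀ s : OneQH.Seqs j,
          (𝒮 s).1.length = Nat.card (Set.Iic j) ∧
          (∀ t : Fin ((𝒮 s).1.length + 1), (𝒮 s).1 t = OneQH.partialSum D s.1 t.val) ∧
          ∀ m : Fin (Nat.card (Set.Iic j)), Nonempty
            (OneQH.SubQuot (OneQH.partialSum D s.1 (m.val + 1)) (OneQH.partialSum D s.1 m.val)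
              ≃ₗ[A] OneQH.Simp e (s.1 m))) ∧
    -- (2) `𝔎 i` is the kernel of `∇(n) ↠ ∇(i)`, which does not depend on the surjection;
    -- `∇(n) / 𝔎 j` is identified with `∇(j)` through any surjection `p`
    (∃ 𝔎 : Q₀ → Submodule A (OneQH.costd K e (⊤ : Q₀)),
      (∀ i,
        (∃ p : OneQH.costd K e (⊤ : Q₀) →ₗ[A] OneQH.costd K e i, Function.Surjective p) ∧
        ∀ p : OneQH.costd K e (⊤ : Q₀) →ₗ[A] OneQH.costd K e i, Function.Surjective p →
          LinearMap.ker p = 𝔎 i) ∧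
      (∀ i k, 𝔎 k ≤ 𝔎 i ↔ i ≤ k) ∧
      ∀ p : OneQH.costd K e (⊤ : Q₀) →ₗ[A] OneQH.costd K e j, Function.Surjective p →
      ∃ 𝒮' : OneQH.Seqs j → OneQH.JHFiltration A (OneQH.costd K e j),
        Function.Bijective 𝒮' ∧
        ∀ s : OneQH.Seqs j,
          (𝒮' s).1.length = Nat.card (Set.Iic j) ∧
          (∀ t : Fin ((𝒮' s).1.length + 1), (𝒮' s).1 t.rev = (OneQH.partialInf 𝔎 s.1 t.val).map p) ∧
          ∀ m : Fin (Nat.card (Set.Iic j)), Nonempty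
            (OneQH.SubQuot ((OneQH.partialInf 𝔎 s.1 m.val).map p)
                ((OneQH.partialInf 𝔎 s.1 (m.val + 1)).map p)
              ≃ₗ[A] OneQH.Simp e (s.1 m))) := by
  exact ⟨hA.jhFiltration_std he j, hA.jhFiltration_costd he j⟩
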